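/- **Setting.** A composition $\alpha=[\alpha_1,\dots,\alpha_m]$ is a finite (possibly empty) tuple of positive integers, with size $|\alpha|=\sum_i\alpha_i$ and length $\ell(\alpha)=m$; $\gamma\models n$ means that $\gamma$ is a composition of size $n$ (there is none if $n<0$). Let $\mathsf{NSym}$ be the free associative $\mathbb{Q}$-algebra on $H_1,H_2,\dots$, with $H_0=1$, $H_{-r}=0$ for $r>0$, $H_\alpha=H_{\alpha_1}\cdots H_{\alpha_m}$ and comultiplication $\Delta H_n=\sum_{i+j=n}H_i\otimes H_j$. Let $\mathsf{QSym}$ be its graded dual algebra, with $\langle H_\alpha,M_\beta\rangle=\delta_{\alpha,\beta}$ and $F_\alpha=\sum_{\beta\le\alpha}M_\beta$ (the sum is over the refinements $\beta$ of $\alpha$); write $F_s=F_{[s]}$. For $F\in\mathsf{QSym}$ let $F^\perp$ be the operator on $\mathsf{NSym}$ with $\langle F^\perp x,G\rangle=\langle x,FG\rangle$ for all $G\in\mathsf{QSym}$. Put $\mathbb{B}_m=\sum_{i\ge0}(-1)^iH_{m+i}F_{1^i}^\perp$ (where $H_{m+i}$ acts by left multiplication) and $\mathfrak{S}_\alpha=\mathbb{B}_{\alpha_1}\cdots\mathbb{B}_{\alpha_m}(1)$.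 The dual immaculate functions $\mathfrak{S}^*_\beta\in\mathsf{QSym}$ are determined by $\langle\mathfrak{S}_\alpha,\mathfrak{S}^*_\beta\rangle=\delta_{\alpha,\beta}$. For an integer vector $\beta$ let $\mathrm{sgn}(\beta)=(-1)^{\mathrm{neg}(\beta)}$, with $\mathrm{neg}(\beta)$ the number of negative entries. For $s>0$ and a composition $\alpha$ of length $m$, let $Z_{s,\alpha}$ be the set of $\beta\in\mathbb{Z}^m$ such that * (Z1) $\beta_1+\dots+\beta_m=s$ and $\beta_1+\dots+\beta_i\le s$ for $1\le i<m$; * (Z2) $\alpha_i-\beta_i\ge0$ for all $i$, with equality for at most one $i$; * (Z3) for every $i\in\{1,\dots,m\}$, with $\rho_i=s-(\beta_1+\dots+\beta_{i-1})$: (a) if $\alpha_i>\rho_i$ then $0\le\beta_i\le\rho_i$; (b) if $\alpha_i=\rho_i$ then either $\beta_i=\alpha_i$ and $\beta_{i+1}=\dots=\beta_m=0$, or $\beta_i<0$; (c) if $\alpha_i<\rho_i$ then $\beta_i<0$. For a composition $\gamma$ let $Z^\gamma_{s,\alpha}$ be the (finite) set of $\beta\in Z_{s,\alpha}$ for which deleting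 the zeros of $\alpha-\beta$ gives $\gamma$, and let $c^\gamma_{s,\alpha}=\sum_{\beta\in Z^\gamma_{s,\alpha}}\mathrm{sgn}(\beta)$. If $\ell(\gamma)=m-1$, let $k$ be the least integer with $1\le k\le m$ such that $\alpha_i=\gamma_{i-1}$ for all $k<i\le m$, and let $r$ be the largest integer with $k\le r\le m$ such that $\alpha_k<\alpha_{k+1}<\dots<\alpha_r$. **Theorem.** Let $s$ be a positive integer and $\alpha$ a composition. 1. $\displaystyle F_s^\perp\mathfrak{S}_\alpha=\sum_{\gamma\models|\alpha|-s}c^\gamma_{s,\alpha}\,\mathfrak{S}_\gamma$. 2. For every $\gamma\models|\alpha|-s$: * if $\ell(\gamma)=\ell(\alpha)$ and $\alpha-\gamma$ satisfies (Z1)–(Z3), then $c^\gamma_{s,\alpha}=\mathrm{sgn}(\alpha-\gamma)$; * if $\ell(\gamma)=\ell(\alpha)-1$, $r-k$ is even, and $(\alpha_1-\gamma_1,\dots,\alpha_{k-1}-\gamma_{k-1},\alpha_k,0,\dots,0)\in\mathbb{Z}^m$ satisfies (Z1)–(Z3), then $c^\gamma_{s,\alpha}=\mathrm{sgn}(\alpha_1-\gamma_1,\dots,\alpha_{k-1}-\gamma_{k-1})$;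 * in all other cases $c^\gamma_{s,\alpha}=0$. In particular $c^\gamma_{s,\alpha}\in\{0,1,-1\}$. 3. The family $(\mathfrak{S}^*_\beta)_\beta$ exists and is unique, and $\displaystyle F_s\,\mathfrak{S}^*_\alpha=\sum_{\beta\models|\alpha|+s}c^{\alpha}_{s,\beta}\,\mathfrak{S}^*_\beta$. 4. $\displaystyle H_s\,\mathfrak{S}_\alpha=\mathfrak{S}_{[s,\alpha]}+\sum_{t=1}^{|\alpha|}\ \sum_{\gamma\models|\alpha|-t}c^\gamma_{t,\alpha}\,\mathfrak{S}_{[s+t,\gamma]}$. -/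

import Mathlib

open scoped TensorProduct

noncomputable section

namespace Immaculate

/-! ### Compositions -/

/-- A composition: a finite tuple of positive integers. -/
abbrev Comp : Type := List ℕ+

/-- The size of a composition, that is the sum of its parts. -/
def size (α : Comp) : ℕ := (α.map (fun a : ℕ+ => (a : ℕ))).sum

/-- A composition, regarded as a tuple of integers. -/
def toInts (α : Comp) : List ℤ := α.map (fun a : ℕ+ => (a : ℤ))

theorem finite_size_eq (n : ℤ) : {α : Comp | (size α : ℤ) = n}.Finite := by
  have hf : (Set.range (fun c : Composition n.toNat => c.blocks)).Finite := Set.finite_range _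
  refine Set.Finite.of_injOn (f := fun α : Comp => α.map (fun a : ℕ+ => (a : ℕ))) ?_ ?_ hf
  · intro α hα
    have h : size α = n.toNat := by
      have : (size α : ℤ) = n := hα
      omega
    refine ⟨⟨α.map (fun a : ℕ+ => (a : ℕ)), ?_, h⟩, rfl⟩
    intro i hi
    obtain ⟨a, _, rfl⟩ := List.mem_map.1 hi
    exact a.pos
  · exact (List.map_injective_iff.2 PNat.coe_injective).injOn

/-- The finite set of all compositions of the integer `n` (empty if `n` is negative). -/
def compsOf (n : ℤ) : Finset Comp := (finite_size_eq n).toFinset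

theorem mem_compsOf {n : ℤ} {α : Comp} : α ∈ compsOf n ↔ (size α : ℤ) = n := by
  simp [compsOf]

/-- The set of proper partial sums `{α₁, α₁ + α₂, …, α₁ + ⋯ + α_{m-1}}` of a composition. -/
def descents (α : Comp) : Finset ℕ := (Finset.Ico 1 α.length).image (fun i => size (α.take i))

/-! ### Non-commutative symmetric functions -/

/-- The free associative `ℚ`-algebra on generators `H₁, H₂, …`. -/
abbrev NSym : Type := FreeAlgebra ℚ ℕ+

/-- `H n` for an integer index, with `H 0 = 1` and `H n = 0` for negative `n`. -/
def H : ℤ → NSym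
  | Int.ofNat 0 => 1
  | Int.ofNat (n + 1) => FreeAlgebra.ι ℚ n.succPNat
  | Int.negSucc _ => 0

/-- The complete homogeneous function `H_α = H_{α₁} ⋯ H_{α_m}`. -/
def HH (α : Comp) : NSym := (α.map (fun a : ℕ+ => H (a : ℤ))).prod

theorem H_pnat (a : ℕ+) : H (a : ℤ) = FreeAlgebra.ι ℚ a := by
  obtain ⟨n, hn⟩ := a
  cases n with
  | zero => exact absurd hn (lt_irrefl _)
  | succ n => rfl

/-- The `H_α` form a basis of `NSym`. -/
def HBasis : Module.Basis Comp ℚ NSym :=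
  (FreeAlgebra.basisFreeMonoid ℚ ℕ+).reindex FreeMonoid.toList

theorem HBasis_apply (α : Comp) : HBasis α = HH α := by
  rw [HBasis, Module.Basis.reindex_apply]
  change MonoidAlgebra.lift ℚ (FreeAlgebra ℚ ℕ+) (FreeMonoid ℕ+)
    (FreeMonoid.lift (FreeAlgebra.ι ℚ))
    (MonoidAlgebra.of ℚ (FreeMonoid ℕ+) (FreeMonoid.ofList α)) = _
  rw [MonoidAlgebra.lift_of, FreeMonoid.lift_ofList, HH]
  simp only [H_pnat]

/-- The comultiplication of `NSym`: the algebra map with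
`Δ(H_n) = ∑_{i + j = n} H_i ⊗ H_j`. -/
def comul : NSym →ₐ[ℚ] NSym ⊗[ℚ] NSym :=
  FreeAlgebra.lift ℚ fun n : ℕ+ =>
    ∑ p ∈ Finset.HasAntidiagonal.antidiagonal (n : ℕ), H (p.1 : ℤ) ⊗ₜ[ℚ] H (p.2 : ℤ)

/-- The span of all `H_β ⊗ H_γ` of total degree `n`. -/
def tdeg (n : ℕ) : Submodule ℚ (NSym ⊗[ℚ] NSym) :=
  Submodule.span ℚ {t | ∃ β γ : Comp, size β + size γ = n ∧ t = HH β ⊗ₜ[ℚ] HH γ}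

theorem H_nat (n : ℕ) : ∃ β : Comp, size β = n ∧ H (n : ℤ) = HH β := by
  cases n with
  | zero => exact ⟨[], rfl, rfl⟩
  | succ n => exact ⟨[n.succPNat], by simp [size], by simp [HH]⟩

theorem HH_append (β γ : Comp) : HH (β ++ γ) = HH β * HH γ := by
  simp [HH]

theorem size_append (β γ : Comp) : size (β ++ γ) = size β + size γ := by
  simp [size]

theorem mul_mem_tdeg {m n : ℕ} {x y : NSym ⊗[ℚ] NSym} (hx : x ∈ tdeg m) (hy : y ∈ tdeg n) :
    x * y ∈ tdeg (m + n) := by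
  have h : x * y ∈ tdeg m * tdeg n := Submodule.mul_mem_mul hx hy
  rw [tdeg, tdeg, Submodule.span_mul_span] at h
  refine Submodule.span_mono ?_ h
  rintro _ ⟨_, ⟨β, γ, h1, rfl⟩, _, ⟨β', γ', h2, rfl⟩, rfl⟩
  refine ⟨β ++ β', γ ++ γ', ?_, ?_⟩
  · rw [size_append, size_append]; omega
  · simp [HH_append]

theorem comul_HH_mem (α : Comp) : comul (HH α) ∈ tdeg (size α) := by
  induction α with
  | nil =>
    have : comul (HH []) = HH [] ⊗ₜ[ℚ] HH [] := by
      simp [HH, Algebra.TensorProduct.one_def]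
    rw [this]
    exact Submodule.subset_span ⟨[], [], rfl, rfl⟩
  | cons a α ih =>
    have h1 : HH (a :: α) = H (a : ℤ) * HH α := by simp [HH]
    have h2 : size (a :: α) = (a : ℕ) + size α := by simp [size]
    rw [h1, h2, map_mul]
    refine mul_mem_tdeg ?_ ih
    rw [H_pnat, comul, FreeAlgebra.lift_ι_apply]
    refine Submodule.sum_mem _ fun p hp => ?_
    obtain ⟨β, hβ, e1⟩ := H_nat p.1
    obtain ⟨γ, hγ, e2⟩ := H_nat p.2
    rw [e1, e2]
    refine Submodule.subset_span ⟨β, γ, ?_, rfl⟩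
    rw [hβ, hγ]
    exact Finset.HasAntidiagonal.mem_antidiagonal.1 hp

/-! ### Quasi-symmetric functions, as the graded dual of `NSym` -/

/-- `QSym` is the graded dual of `NSym`: the linear functionals on `NSym` that vanish on all
homogeneous components of sufficiently large degree. -/
def QSym : Submodule ℚ (Module.Dual ℚ NSym) where
  carrier := {f | ∃ N : ℕ, ∀ α : Comp, N < size α → f (HH α) = 0}
  zero_mem' := ⟨0, fun _ _ => rfl⟩
  add_mem' := by
    rintro f g ⟨N, hN⟩ ⟨K, hK⟩
    refine ⟨max N K, fun α h => ?_⟩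
    rw [LinearMap.add_apply, hN α (lt_of_le_of_lt (le_max_left _ _) h),
      hK α (lt_of_le_of_lt (le_max_right _ _) h), add_zero]
  smul_mem' := by
    rintro c f ⟨N, hN⟩
    exact ⟨N, fun α h => by rw [LinearMap.smul_apply, hN α h, smul_zero]⟩

/-- The pairing `⟨x, G⟩` of `NSym` with `QSym`. -/
def pairing (x : NSym) (G : QSym) : ℚ := (G : Module.Dual ℚ NSym) x

/-- The product of two functionals, dual to the comultiplication: `⟨x, F G⟩ = ⟨Δ x, F ⊗ G⟩`. -/
def dualMul (F G : Module.Dual ℚ NSym) : Module.Dual ℚ NSym :=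
  LinearMap.mul' ℚ ℚ ∘ₗ TensorProduct.map F G ∘ₗ comul.toLinearMap

theorem dualMul_mem {F G : Module.Dual ℚ NSym} (hF : F ∈ QSym) (hG : G ∈ QSym) :
    dualMul F G ∈ QSym := by
  obtain ⟨N, hN⟩ := hF
  obtain ⟨K, hK⟩ := hG
  refine ⟨N + K, fun α h => ?_⟩
  have key : ∀ t ∈ tdeg (size α), (LinearMap.mul' ℚ ℚ ∘ₗ TensorProduct.map F G) t = 0 := by
    intro t ht
    have hle : tdeg (size α) ≤ LinearMap.ker (LinearMap.mul' ℚ ℚ ∘ₗ TensorProduct.map F G) := by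
      refine Submodule.span_le.2 ?_
      rintro _ ⟨β, γ, hs, rfl⟩
      have : N < size β ∨ K < size γ := by omega
      rcases this with h' | h'
      · simp [hN β h']
      · simp [hK γ h']
    exact hle ht
  exact key _ (comul_HH_mem α)

instance : Mul QSym := ⟨fun F G => ⟨dualMul F G, dualMul_mem F.2 G.2⟩⟩

/-- The monomial quasi-symmetric function `M_α`, dual to the basis `H_α`. -/
def M (α : Comp) : QSym :=
  ⟨HBasis.coord α, size α, fun β h => by
    rw [← HBasis_apply, Module.Basis.coord_apply, Module.Basis.repr_self,
      Finsupp.single_eq_of_ne]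
    rintro rfl
    exact lt_irrefl _ h⟩

theorem pairing_HH_M (α β : Comp) : pairing (HH α) (M β) = if α = β then 1 else 0 := by
  rw [← HBasis_apply]
  simp [pairing, M, Finsupp.single_apply]

/-- The fundamental quasi-symmetric function `F_α = ∑_{β ≤ α} M_β`, the sum over all `β` of
the same size as `α` that are finer than or equal to `α`. -/
def F (α : Comp) : QSym :=
  ∑ β ∈ compsOf (size α) with descents α ⊆ descents β, M β

/-- The operator `G^⊥` on `NSym`, `x ↦ (G ⊗ id)(Δ x)`; it is the adjoint of multiplication
by `G`, see `pairing_perp` and `perp_unique`. -/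
def perp (G : QSym) : NSym →ₗ[ℚ] NSym :=
  (TensorProduct.lid ℚ NSym).toLinearMap ∘ₗ
    LinearMap.rTensor NSym (G : Module.Dual ℚ NSym) ∘ₗ comul.toLinearMap

theorem pairing_perp (G K : QSym) (x : NSym) :
    pairing (perp G x) K = pairing x (G * K) := by
  have : ∀ t : NSym ⊗[ℚ] NSym,
      (K : Module.Dual ℚ NSym) (TensorProduct.lid ℚ NSym
        (LinearMap.rTensor NSym (G : Module.Dual ℚ NSym) t)) =
      LinearMap.mul' ℚ ℚ (TensorProduct.map (G : Module.Dual ℚ NSym)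
        (K : Module.Dual ℚ NSym) t) := by
    intro t
    induction t with
    | zero => simp
    | tmul x y => simp
    | add x y hx hy => simp only [map_add, hx, hy]
  exact this _

theorem eq_of_pairing {x y : NSym} (h : ∀ K : QSym, pairing x K = pairing y K) : x = y :=
  HBasis.ext_elem fun α => h (M α)

theorem perp_unique (G : QSym) (T : NSym → NSym)
    (h : ∀ (x : NSym) (K : QSym), pairing (T x) K = pairing x (G * K)) : T = perp G :=
  funext fun x => eq_of_pairing fun K => by rw [h, pairing_perp]

/-! ### Bernstein operators and immaculate functions -/

/-- The non-commutative Bernstein operator `𝔹_m = ∑_{i ≥ 0} (-1)^i H_{m+i} F_{1^i}^⊥`; for each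
argument only finitely many terms are nonzero, see `bernstein_support`. -/
def bernstein (m : ℤ) (x : NSym) : NSym :=
  ∑ᶠ i : ℕ, (-1 : ℚ) ^ i • (H (m + i) * perp (F (List.replicate i 1)) x)

theorem F_HH_of_ne {α β : Comp} (h : size α ≠ size β) :
    (F α : Module.Dual ℚ NSym) (HH β) = 0 := by
  rw [F, AddSubmonoidClass.coe_finsetSum, LinearMap.sum_apply]
  refine Finset.sum_eq_zero fun γ hγ => ?_
  have hs := mem_compsOf.1 (Finset.mem_filter.1 hγ).1
  have := pairing_HH_M β γ
  rw [if_neg] at this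
  · exact this
  · rintro rfl
    exact h (by exact_mod_cast hs.symm)

theorem bernstein_support (m : ℤ) (x : NSym) :
    (Function.support fun i : ℕ =>
      (-1 : ℚ) ^ i • (H (m + i) * perp (F (List.replicate i 1)) x)).Finite := by
  have key : ∀ x : NSym, ∃ N : ℕ, ∀ i, N < i → perp (F (List.replicate i 1)) x = 0 := by
    intro x
    have hx : x ∈ Submodule.span ℚ (Set.range HBasis) := HBasis.mem_span x
    induction hx using Submodule.span_induction with
    | zero => exact ⟨0, fun i _ => map_zero _⟩
    | mem y hy =>
      obtain ⟨α, rfl⟩ := hy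
      refine ⟨size α, fun i h => ?_⟩
      rw [HBasis_apply]
      have hle : tdeg (size α) ≤ LinearMap.ker (LinearMap.rTensor NSym
          (F (List.replicate i 1) : Module.Dual ℚ NSym)) := by
        refine Submodule.span_le.2 ?_
        rintro _ ⟨β, γ, hs, rfl⟩
        have hi : size (List.replicate i 1) ≠ size β := by
          have : size (List.replicate i 1) = i := by simp [size]
          omega
        simp [F_HH_of_ne hi]
      have h0 := hle (comul_HH_mem α)
      rw [LinearMap.mem_ker] at h0
      simp only [perp, LinearMap.comp_apply, AlgHom.toLinearMap_apply, h0, map_zero]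
    | add x y _ _ hx hy =>
      obtain ⟨N, hN⟩ := hx
      obtain ⟨K, hK⟩ := hy
      refine ⟨max N K, fun i h => ?_⟩
      rw [map_add, hN i (lt_of_le_of_lt (le_max_left _ _) h),
        hK i (lt_of_le_of_lt (le_max_right _ _) h), add_zero]
    | smul c x _ hx =>
      obtain ⟨N, hN⟩ := hx
      exact ⟨N, fun i h => by rw [map_smul, hN i h, smul_zero]⟩
  obtain ⟨N, hN⟩ := key x
  refine (Set.finite_le_nat N).subset fun i hi => ?_
  by_contra hlt
  exact hi (by simp [hN i (not_le.1 hlt)])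

/-- The immaculate function `𝔖_α = 𝔹_{α₁} ⋯ 𝔹_{α_m}(1)` of a tuple of integers. -/
def immaculateZ (α : List ℤ) : NSym := α.foldr bernstein 1

/-- The immaculate function `𝔖_α` of a composition. -/
def immaculate (α : Comp) : NSym := immaculateZ (toInts α)

/-- `D` is the family of dual immaculate functions: `⟨𝔖_α, D_β⟩ = δ_{α,β}`. -/
def IsDualImmaculate (D : Comp → QSym) : Prop :=
  ∀ α β : Comp, pairing (immaculate α) (D β) = if α = β then 1 else 0

/-! ### The coefficients -/

/-- The entry `a_i` of a tuple, for `1 ≤ i ≤ length a` (numbering starts at `1`). -/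
def entry (a : List ℤ) (i : ℕ) : ℤ := a.getD (i - 1) 0

/-- The sign `(-1)^(number of negative entries)`. -/
def sgn (b : List ℤ) : ℤ := (-1) ^ b.countP (fun t => decide (t < 0))

/-- Condition (Z1): the whole sum of `β` is `s`, and no partial sum exceeds `s`. -/
def Z1 (s : ℤ) (β : List ℤ) : Prop :=
  β.sum = s ∧ ∀ i, 1 ≤ i → i < β.length → (β.take i).sum ≤ s

/-- Condition (Z2): `α_i - β_i ≥ 0` for all `i`, with equality for at most one `i`. -/
def Z2 (α β : List ℤ) : Prop :=
  (∀ i, 1 ≤ i → i ≤ α.length → 0 ≤ entry α i - entry β i) ∧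
  ∀ i j, 1 ≤ i → i ≤ α.length → 1 ≤ j → j ≤ α.length →
    entry α i - entry β i = 0 → entry α j - entry β j = 0 → i = j

/-- Condition (Z3), comparing `α_i` with `s - (β₁ + ⋯ + β_{i-1})` for every `i`. -/
def Z3 (s : ℤ) (α β : List ℤ) : Prop :=
  ∀ i, 1 ≤ i → i ≤ α.length →
    (s - (β.take (i - 1)).sum < entry α i →
      0 ≤ entry β i ∧ entry β i ≤ s - (β.take (i - 1)).sum) ∧
    (entry α i = s - (β.take (i - 1)).sum →
      (entry β i = entry α i ∧ ∀ j, i < j → j ≤ α.length → entry β j = 0) ∨ entry β i < 0) ∧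
    (entry α i < s - (β.take (i - 1)).sum → entry β i < 0)

/-- The set `Z_{s,α}` of integer vectors `β` of the same length as `α` satisfying
(Z1), (Z2) and (Z3). -/
def ZSet (s : ℕ+) (α : Comp) : Set (List ℤ) :=
  {β | β.length = α.length ∧ Z1 s β ∧ Z2 (toInts α) β ∧ Z3 s (toInts α) β}

/-- The entrywise difference of two tuples (cut off at the length of the shorter one). -/
def diff (α γ : Comp) : List ℤ := List.zipWith (fun x y => x - y) (toInts α) (toInts γ)

/-- The least `k` with `1 ≤ k ≤ m = ℓ(α)` such that `α_i = γ_{i-1}` for all `k < i ≤ m`. -/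
def kIndex (α γ : Comp) : ℕ :=
  sInf {k | 1 ≤ k ∧ k ≤ α.length ∧
    ∀ i, k < i → i ≤ α.length → entry (toInts α) i = entry (toInts γ) (i - 1)}

/-- The largest `r` with `k ≤ r ≤ m = ℓ(α)` such that `α_k < α_{k+1} < ⋯ < α_r`. -/
def rIndex (α γ : Comp) : ℕ :=
  sSup {r | kIndex α γ ≤ r ∧ r ≤ α.length ∧
    ∀ i, kIndex α γ ≤ i → i < r → entry (toInts α) i < entry (toInts α) (i + 1)}

/-- The vector `(α₁ - γ₁, …, α_{k-1} - γ_{k-1})`. -/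
def headDiff (α γ : Comp) : List ℤ := (diff α γ).take (kIndex α γ - 1)

/-- The vector `(α₁ - γ₁, …, α_{k-1} - γ_{k-1}, α_k, 0, …, 0)`, of length `ℓ(α)`. -/
def paddedDiff (α γ : Comp) : List ℤ :=
  headDiff α γ ++ entry (toInts α) (kIndex α γ) ::
    List.replicate (α.length - kIndex α γ) 0

/-- The set `Z^γ_{s,α}` of all `β` in `Z_{s,α}` for which deleting the zeros of `α - β`
gives `γ`. -/
def ZFiber (s : ℕ+) (α γ : Comp) : Set (List ℤ) :=
  {β | β ∈ ZSet s α ∧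
    (List.zipWith (fun x y => x - y) (toInts α) β).filter (fun t => decide (t ≠ 0)) = toInts γ}

theorem finite_ZFiber (s : ℕ+) (α γ : Comp) : (ZFiber s α γ).Finite := by
  set S : Finset ℤ := insert 0 (toInts γ).toFinset
  have hfin : ((fun l : List S => l.map Subtype.val) '' {l | l.length = α.length}).Finite :=
    (List.finite_length_eq S α.length).image _
  refine Set.Finite.of_injOn
    (f := fun β : List ℤ => List.zipWith (fun x y => x - y) (toInts α) β) ?_ ?_ hfin
  · rintro β ⟨⟨hl, -⟩, hγ⟩
    have hS : ∀ x ∈ List.zipWith (fun x y => x - y) (toInts α) β, x ∈ S := by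
      intro x hx
      by_cases h0 : x = 0
      · simp [S, h0]
      · have : x ∈ toInts γ := by
          rw [← hγ, List.mem_filter]
          exact ⟨hx, by simpa using h0⟩
        simp [S, this]
    refine ⟨(List.zipWith (fun x y => x - y) (toInts α) β).attachWith _ hS, ?_, ?_⟩
    · simp [toInts, hl]
    · simp
  · rintro β ⟨⟨hl, -⟩, -⟩ β' ⟨⟨hl', -⟩, -⟩ h
    have aux : ∀ a b b' : List ℤ, b.length = a.length → b'.length = a.length →
        List.zipWith (fun x y => x - y) a b = List.zipWith (fun x y => x - y) a b' →
        b = b' := by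
      intro a
      induction a with
      | nil =>
        intro b b' h1 h2 _
        rw [List.length_eq_zero_iff.1 h1, List.length_eq_zero_iff.1 h2]
      | cons x a ih =>
        intro b b' h1 h2 h3
        cases b with
        | nil => simp at h1
        | cons y b =>
          cases b' with
          | nil => simp at h2
          | cons y' b' =>
            simp only [List.zipWith_cons_cons, List.cons.injEq] at h3
            simp only [List.length_cons, Nat.add_right_cancel_iff] at h1 h2
            rw [ih b b' h1 h2 h3.2, sub_right_injective h3.1]
    refine aux (toInts α) β β' ?_ ?_ h
    · simp [toInts, hl]
    · simp [toInts, hl']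

/-- The coefficient `c^γ_{s,α} = ∑_{β ∈ Z^γ_{s,α}} sgn(β)`. -/
def coeff (s : ℕ+) (α γ : Comp) : ℤ := ∑ β ∈ (finite_ZFiber s α γ).toFinset, sgn β

end Immaculate

end

open scoped TensorProduct

noncomputable section

namespace Immaculate

/-! ### The one-row and one-column fundamental functions as functionals -/

/-! Write h_s for F_s^⊥ and e_i for F_{1^i}^⊥. Past left multiplication by H_m they obey two-term
rules: h_{s+1} H_m = H_m h_{s+1} + h_s H_{m-1} and e_{i+1} H_m = H_m e_{i+1} + H_{m-1} e_i. By
induction on words in the H's it follows that h_s and e_i commute and that ∑ (-1)^i h_{n-i} e_i = 0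
for n > 0. For Bernstein operators this yields h_s 𝔹_a = ∑_{j≤s} 𝔹_{a-j} h_{s-j}
(`rowPerp_bernstein`) and ∑_{t≥0} 𝔹_{m+t} h_t = H_m (`sum_bernstein_rowPerp`).

For m = a - s the first sum is the part t ≤ s of the second, so also h_s 𝔹_a = H_{a-s} - ∑_{t>s}
𝔹_{a-s+t} h_t. The first form is used for s < a, the second for s ≥ a, where H_{a-s} is 1 or 0; in
both, all Bernstein indices are positive. Iterated over the parts of α, this produces exactly the
vectors of Z_{s,α}: entries 0 ≤ b ≤ s, or entries b = s - t < 0 with a sign, or b = a = s followed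
by zeros (`rowPerp_immaculate`).

If ℓ(γ) = ℓ(α), the only candidate is β = α - γ. If γ is one part shorter, the vanishing entry of α
- β may sit at several places from k on; moving it one place to the right is possible exactly across
an ascent of α and flips the sign, so an alternating sum over the run k, …, r remains
(`fiberSum_tail`).

The left Pieri rule is the second identity with m = s. It puts every H_α into the span of immaculate
functions of the same size, a dimension count makes these a basis, and the dual Pieri rule is the
transpose of the expansion of F_s^⊥. -/

theorem H_of_neg {m : ℤ} (h : m < 0) : H m = 0 := by
  cases m with
  | ofNat n => exact absurd h (by simp)
  | negSucc n => rfl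

theorem H_zero : H 0 = 1 := rfl

theorem HH_cons (a : ℕ+) (α : Comp) : HH (a :: α) = H (a : ℤ) * HH α := by simp [HH]

theorem HH_nil : HH [] = 1 := rfl

theorem size_nil : size [] = 0 := rfl

theorem size_cons (a : ℕ+) (α : Comp) : size (a :: α) = (a : ℕ) + size α := by simp [size]

theorem size_singleton (a : ℕ+) : size [a] = a := by simp [size]

theorem size_replicate_one (i : ℕ) : size (List.replicate i 1) = i := by simp [size]

theorem F_apply_HH (α β : Comp) : (F α : Module.Dual ℚ NSym) (HH β) =
    if size β = size α ∧ descents α ⊆ descents β then 1 else 0 := by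
  rw [F, AddSubmonoidClass.coe_finsetSum, LinearMap.sum_apply]
  have h (γ : Comp) : (M γ : Module.Dual ℚ NSym) (HH β) = if β = γ then 1 else 0 :=
    pairing_HH_M β γ
  simp only [h, Finset.sum_ite_eq, Finset.mem_filter, mem_compsOf, Nat.cast_inj]

/-- The complete function `F_n` for a natural number `n`, with `F_0 = 1`. -/
def rowF : ℕ → QSym
  | 0 => F []
  | n + 1 => F [n.succPNat]

theorem rowF_pnat (s : ℕ+) : rowF s = F [s] := by
  obtain ⟨n, hn⟩ := s
  cases n with
  | zero => exact absurd hn (lt_irrefl _)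
  | succ n => rfl

/-- A single row has no descents, so the inclusion of descent sets is vacuous and only the size
matters. -/
theorem rowF_apply_HH (s : ℕ) (β : Comp) :
    (rowF s : Module.Dual ℚ NSym) (HH β) = if size β = s then 1 else 0 := by
  cases s with
  | zero => simp [rowF, F_apply_HH, descents, size_nil]
  | succ n => simp [rowF, F_apply_HH, descents, size_singleton]

theorem length_le_size (β : Comp) : β.length ≤ size β := by
  induction β with
  | nil => simp [size_nil]
  | cons b β ih => rw [size_cons, List.length_cons]; have := b.pos; omega

theorem eq_replicate_of_length_eq_size {β : Comp} (h : β.length = size β) :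
    β = List.replicate β.length 1 := by
  induction β with
  | nil => rfl
  | cons b β ih =>
    rw [size_cons, List.length_cons] at h
    have h1 := b.pos
    have h2 := length_le_size β
    have hb : b = 1 := PNat.coe_injective (show (b : ℕ) = 1 by omega)
    rw [List.length_cons, List.replicate_succ, ← ih (by omega), hb]

/-- A composition of i whose descents include 1, …, i-1 has i parts, hence all of them equal 1. -/
theorem colF_apply_HH (i : ℕ) (β : Comp) :
    (F (List.replicate i 1) : Module.Dual ℚ NSym) (HH β) =
      if β = List.replicate i 1 then 1 else 0 := by
  rw [F_apply_HH, size_replicate_one]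
  congr 1
  refine propext ⟨fun ⟨hs, hd⟩ => ?_, fun h => ?_⟩
  · have h1 : (descents (List.replicate i 1)) = Finset.Ico 1 i := by
      ext j
      simp only [descents, List.length_replicate, Finset.mem_image, Finset.mem_Ico,
        List.take_replicate, size_replicate_one]
      constructor
      · rintro ⟨a, ha, rfl⟩; omega
      · intro hj; exact ⟨j, hj, by omega⟩
    have h2 : (descents β).card ≤ β.length - 1 := by
      refine Finset.card_image_le.trans ?_
      simp
    have h3 := Finset.card_le_card hd
    rw [h1, Nat.card_Ico] at h3
    have h4 := length_le_size β
    have h5 : β.length = i := by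
      -- The subtraction in `h2` is truncated, so the empty composition is treated apart.
      rcases Nat.eq_zero_or_pos β.length with h0 | h0
      · rw [List.length_eq_zero_iff.1 h0, size_nil] at hs
        omega
      · omega
    have := eq_replicate_of_length_eq_size (β := β) (by omega)
    rwa [h5] at this
  · rw [h, size_replicate_one]
    exact ⟨rfl, subset_rfl⟩

/-- Two linear maps out of `NSym` agree if they agree on all `H_α`. -/
theorem linearMap_ext_HH {V : Type*} [AddCommGroup V] [Module ℚ V] {f g : NSym →ₗ[ℚ] V}
    (h : ∀ α, f (HH α) = g (HH α)) : f = g :=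
  HBasis.ext fun α => by rw [HBasis_apply]; exact h α

theorem rowF_H_mul (s p : ℕ) (y : NSym) : (rowF s : Module.Dual ℚ NSym) (H p * y) =
    if p ≤ s then (rowF (s - p) : Module.Dual ℚ NSym) y else 0 := by
  obtain ⟨β, hβ, e⟩ := H_nat p
  rw [e]
  have : (rowF s : Module.Dual ℚ NSym) ∘ₗ LinearMap.mulLeft ℚ (HH β) =
      if p ≤ s then (rowF (s - p) : Module.Dual ℚ NSym) else 0 := by
    refine linearMap_ext_HH fun α => ?_
    rw [LinearMap.comp_apply, LinearMap.mulLeft_apply, ← HH_append, rowF_apply_HH, size_append, hβ]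
    by_cases h : p ≤ s
    · rw [if_pos h, rowF_apply_HH]
      congr 1
      exact propext (by omega)
    · rw [if_neg h, LinearMap.zero_apply, if_neg (by omega)]
  have h := LinearMap.congr_fun this y
  rw [LinearMap.comp_apply, LinearMap.mulLeft_apply] at h
  rw [h]
  split_ifs <;> rfl

/-- The functional sees only the word H_1^{i+1}, so the left factor must be H_0 or H_1. -/
theorem colF_H_mul (i p : ℕ) (y : NSym) :
    (F (List.replicate (i + 1) 1) : Module.Dual ℚ NSym) (H p * y) =
    (if p = 0 then (F (List.replicate (i + 1) 1) : Module.Dual ℚ NSym) y else 0) +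
    (if p = 1 then (F (List.replicate i 1) : Module.Dual ℚ NSym) y else 0) := by
  rcases p with _ | p
  · simp [H_zero]
  · have : (F (List.replicate (i + 1) 1) : Module.Dual ℚ NSym) ∘ₗ
        LinearMap.mulLeft ℚ (H (p + 1 : ℕ)) =
        if p = 0 then (F (List.replicate i 1) : Module.Dual ℚ NSym) else 0 := by
      refine linearMap_ext_HH fun α => ?_
      have e : H (p + 1 : ℕ) = H (p.succPNat : ℤ) := rfl
      rw [LinearMap.comp_apply, LinearMap.mulLeft_apply, e, ← HH_cons, colF_apply_HH]
      simp only [List.replicate_succ, List.cons.injEq]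
      have e1 : p.succPNat = 1 ↔ p = 0 := by
        rw [← PNat.coe_inj]; simp
      simp only [e1]
      by_cases h : p = 0
      · simp [h, colF_apply_HH]
      · simp [h]
    have h := LinearMap.congr_fun this y
    rw [LinearMap.comp_apply, LinearMap.mulLeft_apply] at h
    rw [h]
    by_cases hp : p = 0 <;> simp [hp]

/-! ### The operators `F_s^⊥` and `F_{1^i}^⊥` -/

/-- The operator `F_s^⊥`. -/
def rowPerp (s : ℕ) : NSym →ₗ[ℚ] NSym := perp (rowF s)

/-- The operator `F_{1^i}^⊥`. -/
def colPerp (i : ℕ) : NSym →ₗ[ℚ] NSym := perp (F (List.replicate i 1))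

/-- Contraction of the first tensor factor against a functional. -/
def contract (f : Module.Dual ℚ NSym) : NSym ⊗[ℚ] NSym →ₗ[ℚ] NSym :=
  (TensorProduct.lid ℚ NSym).toLinearMap ∘ₗ LinearMap.rTensor NSym f

theorem contract_tmul (f : Module.Dual ℚ NSym) (x y : NSym) :
    contract f (x ⊗ₜ y) = f x • y := by
  simp [contract]

theorem perp_apply (G : QSym) (x : NSym) : perp G x = contract G (comul x) := rfl

theorem comul_H (m : ℕ) : comul (H m) =
    ∑ p ∈ Finset.HasAntidiagonal.antidiagonal m, H (p.1 : ℤ) ⊗ₜ[ℚ] H (p.2 : ℤ) := by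
  cases m with
  | zero => simp [H_zero, Algebra.TensorProduct.one_def]
  | succ m =>
    have e : H (m + 1 : ℕ) = H (m.succPNat : ℤ) := rfl
    rw [e, H_pnat, comul, FreeAlgebra.lift_ι_apply]
    rfl

/-- If `f (H_p y) = f_p (y)`, then contracting `Δ(H_m) t` with `f` gives `∑ H_{m-p} f_p(t)`. -/
theorem contract_comul_H_mul (f : Module.Dual ℚ NSym) (g : ℕ → Module.Dual ℚ NSym)
    (hfg : ∀ p y, f (H (p : ℕ) * y) = g p y) (m : ℕ) (t : NSym ⊗[ℚ] NSym) :
    contract f (comul (H m) * t) =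
      ∑ p ∈ Finset.HasAntidiagonal.antidiagonal m, H (p.2 : ℤ) * contract (g p.1) t := by
  induction t with
  | zero => simp
  | tmul x y =>
    rw [comul_H, Finset.sum_mul, map_sum]
    refine Finset.sum_congr rfl fun p _ => ?_
    rw [Algebra.TensorProduct.tmul_mul_tmul, contract_tmul, contract_tmul, hfg,
      mul_smul_comm]
  | add x y hx hy => simp only [mul_add, map_add, hx, hy, Finset.sum_add_distrib]

theorem contract_zero (t : NSym ⊗[ℚ] NSym) : contract 0 t = 0 := by
  simp [contract]

theorem rowPerp_H_mul (s m : ℕ) (x : NSym) : rowPerp s (H m * x) =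
    ∑ p ∈ Finset.HasAntidiagonal.antidiagonal m,
      if p.1 ≤ s then H (p.2 : ℤ) * rowPerp (s - p.1) x else 0 := by
  rw [rowPerp, perp_apply, map_mul, contract_comul_H_mul _
    (fun p => if p ≤ s then (rowF (s - p) : Module.Dual ℚ NSym) else 0)]
  · refine Finset.sum_congr rfl fun p _ => ?_
    split_ifs
    · rfl
    · rw [contract_zero, mul_zero]
  · intro p y
    rw [rowF_H_mul]
    split_ifs <;> rfl

/-- In `rowPerp_H_mul` the term p = 0 splits off, and lowering p by one in the others gives the
expansion for s and m - 1. Negative m is allowed because the Bernstein operators involve such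
indices. -/
theorem rowPerp_succ_H_mul (s : ℕ) (m : ℤ) (x : NSym) : rowPerp (s + 1) (H m * x) =
    H m * rowPerp (s + 1) x + rowPerp s (H (m - 1) * x) := by
  rcases lt_or_ge m 0 with h | h
  · rw [H_of_neg h, H_of_neg (by omega)]
    simp
  · lift m to ℕ using h
    cases m with
    | zero => simp [H_zero, H_of_neg]
    | succ m =>
      have e : ((m + 1 : ℕ) : ℤ) - 1 = (m : ℕ) := by push_cast; ring
      rw [e, rowPerp_H_mul, rowPerp_H_mul, Finset.Nat.sum_antidiagonal_succ]
      simp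

theorem colPerp_succ_H_mul (i : ℕ) (m : ℤ) (x : NSym) : colPerp (i + 1) (H m * x) =
    H m * colPerp (i + 1) x + H (m - 1) * colPerp i x := by
  rcases lt_or_ge m 0 with h | h
  · rw [H_of_neg h, H_of_neg (by omega)]
    simp
  · lift m to ℕ using h
    rw [colPerp, perp_apply, map_mul, contract_comul_H_mul _
      (fun p => (if p = 0 then (F (List.replicate (i + 1) 1) : Module.Dual ℚ NSym) else 0) +
        (if p = 1 then (F (List.replicate i 1) : Module.Dual ℚ NSym) else 0))]
    · cases m with
      | zero => simp [H_zero, H_of_neg, perp_apply]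
      | succ m =>
        have e : ((m + 1 : ℕ) : ℤ) - 1 = (m : ℕ) := by push_cast; ring
        rw [e, Finset.Nat.sum_antidiagonal_succ]
        congr 1
        · simp [perp_apply]
        · cases m with
          | zero => simp [colPerp, perp_apply]
          | succ m =>
            rw [Finset.Nat.sum_antidiagonal_succ, Finset.sum_eq_zero]
            · simp [colPerp, perp_apply]
            · intro p _
              simp [contract_zero]
    · intro p y
      rw [colF_H_mul, LinearMap.add_apply]
      congr 1 <;> split_ifs <;> rfl

theorem counit_H_mul (f : Module.Dual ℚ NSym) (hf : ∀ β, f (HH β) = if β = [] then 1 else 0)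
    (p : ℕ) (y : NSym) : f (H p * y) = if p = 0 then f y else 0 := by
  rcases p with _ | p
  · simp [H_zero]
  · have : f ∘ₗ LinearMap.mulLeft ℚ (H (p + 1 : ℕ)) = 0 := by
      refine linearMap_ext_HH fun α => ?_
      have e : H (p + 1 : ℕ) = H (p.succPNat : ℤ) := rfl
      rw [LinearMap.comp_apply, LinearMap.mulLeft_apply, e, ← HH_cons, hf]
      simp
    simpa using LinearMap.congr_fun this y

/-- Such an f is the counit, and this is the counit law; it makes F_0^⊥ and F_{1^0}^⊥ the identity.
-/
theorem contract_counit (f : Module.Dual ℚ NSym) (hf : ∀ β, f (HH β) = if β = [] then 1 else 0)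
    (x : NSym) : contract f (comul x) = x := by
  have : contract f ∘ₗ comul.toLinearMap = LinearMap.id := by
    refine linearMap_ext_HH fun α => ?_
    induction α with
    | nil =>
      have := hf []
      simp [HH_nil, Algebra.TensorProduct.one_def, contract_tmul] at this ⊢
      rw [this, one_smul]
    | cons a α ih =>
      rw [LinearMap.comp_apply, AlgHom.toLinearMap_apply, LinearMap.id_apply] at ih ⊢
      have e : H (a : ℤ) = H ((a : ℕ) : ℤ) := rfl
      rw [HH_cons, map_mul, e, contract_comul_H_mul f (fun p => if p = 0 then f else 0),
        Finset.sum_eq_single (0, (a : ℕ))]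
      · simp [ih]
      · intro p hp h0
        have : p.1 ≠ 0 := by
          intro h
          apply h0
          have := Finset.HasAntidiagonal.mem_antidiagonal.1 hp
          ext <;> simp <;> omega
        simp [this, contract_zero]
      · intro h
        simp at h
      · intro p y
        rw [counit_H_mul f hf]
        split_ifs <;> rfl
  exact LinearMap.congr_fun this x

theorem rowPerp_zero (x : NSym) : rowPerp 0 x = x := by
  refine contract_counit _ (fun β => ?_) x
  rw [rowF_apply_HH]
  congr 1
  refine propext ⟨fun h => ?_, fun h => by rw [h, size_nil]⟩
  have := length_le_size β
  exact List.length_eq_zero_iff.1 (by omega)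

theorem colPerp_zero (x : NSym) : colPerp 0 x = x :=
  contract_counit _ (fun β => by rw [colF_apply_HH]; rfl) x

theorem rowPerp_succ_one (s : ℕ) : rowPerp (s + 1) 1 = 0 := by
  rw [rowPerp, perp_apply, map_one, Algebra.TensorProduct.one_def, contract_tmul, ← HH_nil,
    rowF_apply_HH]
  simp [size_nil]

theorem colPerp_succ_one (i : ℕ) : colPerp (i + 1) 1 = 0 := by
  rw [colPerp, perp_apply, map_one, Algebra.TensorProduct.one_def, contract_tmul, ← HH_nil,
    colF_apply_HH]
  simp [List.replicate_succ]

/-- The two-term rules expand both composites on H_m x into the same terms, up to composites with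
smaller s, smaller i or a shorter word; hence the nested inductions. -/
theorem rowPerp_colPerp_comm (s i : ℕ) (x : NSym) :
    rowPerp s (colPerp i x) = colPerp i (rowPerp s x) := by
  induction s generalizing i x with
  | zero => simp only [rowPerp_zero]
  | succ s ihs =>
    induction i generalizing x with
    | zero => simp only [colPerp_zero]
    | succ i ihi =>
      have : rowPerp (s + 1) ∘ₗ colPerp (i + 1) = colPerp (i + 1) ∘ₗ rowPerp (s + 1) := by
        refine linearMap_ext_HH fun α => ?_
        simp only [LinearMap.comp_apply]
        induction α with
        | nil => simp [HH_nil, rowPerp_succ_one, colPerp_succ_one]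
        | cons a α ih =>
          rw [HH_cons, colPerp_succ_H_mul, map_add, rowPerp_succ_H_mul, rowPerp_succ_H_mul,
            rowPerp_succ_H_mul, map_add, colPerp_succ_H_mul, ← ihs, colPerp_succ_H_mul, map_add, ih,
            ihi]
          abel
      exact LinearMap.congr_fun this x

/-- The alternating sum kills 1 and commutes with left multiplication by H_m: the correction terms
of the column rule (`h1`) and of the row rule (`h2`) cancel. -/
theorem sum_rowPerp_colPerp (n : ℕ) (x : NSym) :
    ∑ p ∈ Finset.HasAntidiagonal.antidiagonal (n + 1),
      (-1 : ℚ) ^ p.1 • rowPerp p.2 (colPerp p.1 x) = 0 := by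
  have : ∑ p ∈ Finset.HasAntidiagonal.antidiagonal (n + 1),
      (-1 : ℚ) ^ p.1 • (rowPerp p.2 ∘ₗ colPerp p.1) = 0 := by
    refine linearMap_ext_HH fun α => ?_
    simp only [LinearMap.sum_apply, LinearMap.smul_apply, LinearMap.comp_apply,
      LinearMap.zero_apply]
    induction α with
    | nil =>
      refine Finset.sum_eq_zero fun p hp => ?_
      rw [HH_nil]
      obtain ⟨i, t⟩ := p
      rw [Finset.HasAntidiagonal.mem_antidiagonal] at hp
      rcases i with _ | i
      · obtain ⟨t, rfl⟩ : ∃ u, t = u + 1 := ⟨n, by simpa using hp⟩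
        simp [colPerp_zero, rowPerp_succ_one]
      · simp [colPerp_succ_one]
    | cons a α ih =>
      rw [HH_cons]
      set m : ℤ := (a : ℤ)
      set y := HH α
      have h1 : ∑ p ∈ Finset.HasAntidiagonal.antidiagonal (n + 1),
          (-1 : ℚ) ^ p.1 • rowPerp p.2 (colPerp p.1 (H m * y)) =
          ∑ p ∈ Finset.HasAntidiagonal.antidiagonal (n + 1),
            (-1 : ℚ) ^ p.1 • rowPerp p.2 (H m * colPerp p.1 y) -
          ∑ p ∈ Finset.HasAntidiagonal.antidiagonal n,
            (-1 : ℚ) ^ p.1 • rowPerp p.2 (H (m - 1) * colPerp p.1 y) := by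
        rw [Finset.Nat.sum_antidiagonal_succ, Finset.Nat.sum_antidiagonal_succ]
        simp only [colPerp_zero, colPerp_succ_H_mul, map_add, smul_add, Finset.sum_add_distrib,
          pow_succ, mul_neg, mul_one, neg_smul, Finset.sum_neg_distrib]
        abel
      have h2 : ∑ p ∈ Finset.HasAntidiagonal.antidiagonal (n + 1),
            (-1 : ℚ) ^ p.1 • rowPerp p.2 (H m * colPerp p.1 y) =
          H m * ∑ p ∈ Finset.HasAntidiagonal.antidiagonal (n + 1),
            (-1 : ℚ) ^ p.1 • rowPerp p.2 (colPerp p.1 y) +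
          ∑ p ∈ Finset.HasAntidiagonal.antidiagonal n,
            (-1 : ℚ) ^ p.1 • rowPerp p.2 (H (m - 1) * colPerp p.1 y) := by
        rw [Finset.Nat.sum_antidiagonal_succ', Finset.Nat.sum_antidiagonal_succ', mul_add,
          Finset.mul_sum]
        simp only [rowPerp_zero, rowPerp_succ_H_mul, smul_add, Finset.sum_add_distrib,
          mul_smul_comm]
        abel
      rw [h1, h2, ih, mul_zero, zero_add, sub_self]
  have h := LinearMap.congr_fun this x
  simpa only [LinearMap.sum_apply, LinearMap.smul_apply, LinearMap.comp_apply,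
    LinearMap.zero_apply] using h

/-! ### Bernstein operators -/

/-- F_{1^i}^⊥ lowers the index of each factor H by at most one, so on a word it vanishes once i
exceeds the length. -/
theorem exists_colPerp_eq_zero (x : NSym) : ∃ N : ℕ, ∀ i, N ≤ i → colPerp i x = 0 := by
  have hx : x ∈ Submodule.span ℚ (Set.range HBasis) := HBasis.mem_span x
  induction hx using Submodule.span_induction with
  | zero => exact ⟨0, fun i _ => map_zero _⟩
  | mem y hy =>
    obtain ⟨α, rfl⟩ := hy
    rw [HBasis_apply]
    induction α with
    | nil =>
      refine ⟨1, fun i h => ?_⟩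
      obtain ⟨j, rfl⟩ := Nat.exists_eq_add_of_le' h
      exact colPerp_succ_one j
    | cons a α ih =>
      obtain ⟨N, hN⟩ := ih
      refine ⟨N + 1, fun i h => ?_⟩
      obtain ⟨j, rfl⟩ : ∃ j, i = j + 1 := ⟨i - 1, by omega⟩
      rw [HH_cons, colPerp_succ_H_mul, hN _ (by omega), hN _ (by omega), mul_zero, mul_zero,
        zero_add]
  | add x y _ _ hx hy =>
    obtain ⟨N, hN⟩ := hx
    obtain ⟨K, hK⟩ := hy
    refine ⟨max N K, fun i h => ?_⟩
    rw [map_add, hN i (le_trans (le_max_left _ _) h), hK i (le_trans (le_max_right _ _) h),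
      add_zero]
  | smul c x _ hx =>
    obtain ⟨N, hN⟩ := hx
    exact ⟨N, fun i h => by rw [map_smul, hN i h, smul_zero]⟩

theorem bernstein_eq_sum {N : ℕ} {x : NSym} (h : ∀ i, N ≤ i → colPerp i x = 0) (m : ℤ) :
    bernstein m x = ∑ i ∈ Finset.range N, (-1 : ℚ) ^ i • (H (m + i) * colPerp i x) := by
  rw [bernstein]
  refine finsum_eq_finsetSum_of_support_subset _ fun i hi => ?_
  simp only [Finset.coe_range, Set.mem_Iio]
  by_contra hlt
  refine hi ?_
  have := h i (not_lt.1 hlt)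
  rw [colPerp] at this
  dsimp only
  rw [this, mul_zero, smul_zero]

theorem bernstein_add (m : ℤ) (x y : NSym) :
    bernstein m (x + y) = bernstein m x + bernstein m y := by
  rw [bernstein, bernstein, bernstein, ← finsum_add_distrib (bernstein_support m x)
    (bernstein_support m y)]
  simp only [map_add, mul_add, smul_add]

/-- The Bernstein operator as an additive map. -/
def bernsteinHom (m : ℤ) : NSym →+ NSym where
  toFun := bernstein m
  map_zero' := by simp [bernstein]
  map_add' := bernstein_add m

theorem bernstein_sum {ι : Type*} (m : ℤ) (S : Finset ι) (f : ι → NSym) :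
    bernstein m (∑ i ∈ S, f i) = ∑ i ∈ S, bernstein m (f i) := map_sum (bernsteinHom m) f S

theorem bernstein_zsmul (m c : ℤ) (x : NSym) : bernstein m (c • x) = c • bernstein m x :=
  map_zsmul (bernsteinHom m) c x

/-- F_{s+1}^⊥ commutes with each F_{1^i}^⊥, so the two-term rule for H_{m+i} applies term by term.
-/
theorem rowPerp_succ_bernstein (s : ℕ) (m : ℤ) (x : NSym) : rowPerp (s + 1) (bernstein m x) =
    bernstein m (rowPerp (s + 1) x) + rowPerp s (bernstein (m - 1) x) := by
  obtain ⟨N, hN⟩ := exists_colPerp_eq_zero x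
  have hN' : ∀ i, N ≤ i → colPerp i (rowPerp (s + 1) x) = 0 := fun i hi => by
    rw [← rowPerp_colPerp_comm, hN i hi, map_zero]
  rw [bernstein_eq_sum hN, bernstein_eq_sum hN, bernstein_eq_sum hN', map_sum, map_sum,
    ← Finset.sum_add_distrib]
  refine Finset.sum_congr rfl fun i _ => ?_
  rw [map_smul, map_smul, ← smul_add, rowPerp_succ_H_mul, rowPerp_colPerp_comm]
  congr 5
  ring

theorem rowPerp_bernstein (s : ℕ) (m : ℤ) (x : NSym) : rowPerp s (bernstein m x) =
    ∑ j ∈ Finset.range (s + 1), bernstein (m - j) (rowPerp (s - j) x) := by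
  induction s generalizing m with
  | zero => simp [rowPerp_zero]
  | succ s ih =>
    rw [rowPerp_succ_bernstein, ih, Finset.sum_range_succ' _ (s + 1), add_comm (bernstein m _)]
    rw [Nat.cast_zero, sub_zero, Nat.sub_zero, add_left_inj]
    refine Finset.sum_congr rfl fun j _ => ?_
    rw [Nat.add_sub_add_right]
    congr 1
    push_cast
    ring

/-- Left multiplication by `H_m` in terms of Bernstein operators. -/
theorem sum_bernstein_rowPerp {N : ℕ} {x : NSym} (hx : ∀ t, N ≤ t → rowPerp t x = 0) (m : ℤ) :
    ∑ t ∈ Finset.range N, bernstein (m + t) (rowPerp t x) = H m * x := by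
  obtain ⟨K, hK⟩ := exists_colPerp_eq_zero x
  have hz : ∀ i t, K ≤ i ∨ N ≤ t → colPerp i (rowPerp t x) = 0 := by
    rintro i t (h | h)
    · rw [← rowPerp_colPerp_comm, hK i h, map_zero]
    · rw [hx t h, map_zero]
  -- The index of H depends on i + t only. Grouping by n = i + t, the alternating identity kills
  -- every n > 0 and leaves H_m x.
  set f : ℕ × ℕ → NSym := fun p =>
    (-1 : ℚ) ^ p.1 • (H (m + ((p.1 + p.2 : ℕ) : ℤ)) * rowPerp p.2 (colPerp p.1 x)) with hf
  have h1 : ∑ t ∈ Finset.range N, bernstein (m + t) (rowPerp t x) =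
      ∑ p ∈ Finset.range K ×ˢ Finset.range N, f p := by
    rw [Finset.sum_product_right]
    refine Finset.sum_congr rfl fun t _ => ?_
    rw [bernstein_eq_sum (N := K) fun i hi => hz i t (Or.inl hi)]
    refine Finset.sum_congr rfl fun i _ => ?_
    rw [hf]
    dsimp only
    rw [rowPerp_colPerp_comm]
    congr 3
    push_cast
    ring
  have h2 : ∑ n ∈ Finset.range (K + N + 1),
      ∑ p ∈ Finset.HasAntidiagonal.antidiagonal n, f p = f (0, 0) := by
    rw [Finset.sum_range_succ', Finset.sum_eq_zero]
    · simp
    · intro n _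
      have : ∑ p ∈ Finset.HasAntidiagonal.antidiagonal (n + 1), f p =
          H (m + ((n + 1 : ℕ) : ℤ)) * ∑ p ∈ Finset.HasAntidiagonal.antidiagonal (n + 1),
            (-1 : ℚ) ^ p.1 • rowPerp p.2 (colPerp p.1 x) := by
        rw [Finset.mul_sum]
        refine Finset.sum_congr rfl fun p hp => ?_
        rw [hf]
        dsimp only
        rw [Finset.HasAntidiagonal.mem_antidiagonal.1 hp, mul_smul_comm]
      rw [this, sum_rowPerp_colPerp, mul_zero]
  rw [h1]
  rw [Finset.sum_sigma'] at h2
  have h3 : f (0, 0) = H m * x := by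
    simp [hf, rowPerp_zero, colPerp_zero]
  rw [← h3, ← h2]
  refine Finset.sum_bij_ne_zero (fun p _ _ => ⟨p.1 + p.2, p⟩) ?_ ?_ ?_ ?_
  · rintro ⟨i, t⟩ hp _
    simp at hp ⊢
    omega
  · rintro p _ _ q _ _ h
    simp at h
    exact h.2
  · rintro ⟨n, i, t⟩ hp h0
    simp only [Finset.mem_sigma, Finset.HasAntidiagonal.mem_antidiagonal] at hp
    obtain ⟨-, rfl⟩ := hp
    have hit : i < K ∧ t < N := by
      by_contra hcon
      apply h0
      have := hz i t (by omega)
      simp only [hf]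
      rw [rowPerp_colPerp_comm, this, mul_zero, smul_zero]
    exact ⟨(i, t), by simp [hit], h0, rfl⟩
  · intros
    rfl

/-! ### A recursive description of `Z_{s,α}` -/

/-- The condition that (Z3) puts on a single entry `b` of `β`, where `a` is the corresponding
entry of `α` and `s` is what remains of the total. -/
def EntryCond (s a b : ℤ) : Prop :=
  (s < a → 0 ≤ b ∧ b ≤ s) ∧ (a = s → b = a ∨ b < 0) ∧ (a < s → b < 0)

/-- Membership in `Z_{s,α}`, entry by entry. -/
def MemZ : ℤ → Comp → List ℤ → Prop
  | s, [], [] => s = 0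
  | s, a :: α, b :: β => EntryCond s a b ∧ MemZ (s - b) α β
  | _, _, _ => False

/-- The tuple `α - β` with its zeros deleted. -/
def reduced (α : Comp) (β : List ℤ) : List ℤ :=
  (List.zipWith (fun x y => x - y) (toInts α) β).filter (fun t => decide (t ≠ 0))

theorem toInts_cons (a : ℕ+) (α : Comp) : toInts (a :: α) = (a : ℤ) :: toInts α := rfl

theorem toInts_length (α : Comp) : (toInts α).length = α.length := by simp [toInts]

theorem toInts_injective : Function.Injective toInts :=
  List.map_injective_iff.2 fun a b h => PNat.coe_injective (by exact_mod_cast h)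

theorem sum_toInts (α : Comp) : (toInts α).sum = size α := by
  induction α with
  | nil => rfl
  | cons a α ih => rw [toInts_cons, List.sum_cons, ih, size_cons]; push_cast; rfl

theorem MemZ.length_eq {s : ℤ} {α : Comp} {β : List ℤ} (h : MemZ s α β) :
    β.length = α.length := by
  induction α generalizing s β with
  | nil => cases β with
    | nil => rfl
    | cons b β => exact h.elim
  | cons a α ih => cases β with
    | nil => exact h.elim
    | cons b β => rw [List.length_cons, List.length_cons, ih h.2]

theorem MemZ.nonneg {s : ℤ} {α : Comp} {β : List ℤ} (h : MemZ s α β) : 0 ≤ s := by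
  cases α with
  | nil => cases β with
    | nil => exact le_of_eq (Eq.symm h)
    | cons b β => exact h.elim
  | cons a α => cases β with
    | nil => exact h.elim
    | cons b β =>
      by_contra hs
      have ha : (0 : ℤ) < (a : ℤ) := by exact_mod_cast a.pos
      have := h.1.1 (by omega)
      omega

theorem MemZ.sum_eq {s : ℤ} {α : Comp} {β : List ℤ} (h : MemZ s α β) : β.sum = s := by
  induction α generalizing s β with
  | nil => cases β with
    | nil => exact Eq.symm h
    | cons b β => exact h.elim
  | cons a α ih => cases β with
    | nil => exact h.elim
    | cons b β => rw [List.sum_cons, ih h.2]; ring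

/-- Once nothing remains, every part of α exceeds the remaining total, and case (a) forces each
entry to be 0. -/
theorem memZ_zero (α : Comp) (β : List ℤ) :
    MemZ 0 α β ↔ β = List.replicate α.length 0 := by
  induction α generalizing β with
  | nil => cases β with
    | nil => exact ⟨fun _ => rfl, fun _ => rfl⟩
    | cons b β => exact ⟨fun h => h.elim, fun h => by simp at h⟩
  | cons a α ih => cases β with
    | nil => exact ⟨fun h => h.elim, fun h => by simp [List.replicate_succ] at h⟩
    | cons b β =>
      have ha : (0 : ℤ) < (a : ℤ) := by exact_mod_cast a.pos
      rw [List.length_cons, List.replicate_succ, List.cons.injEq]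
      constructor
      · rintro ⟨h1, h2⟩
        have hb : b = 0 := by have := h1.1 ha; omega
        subst hb
        exact ⟨rfl, (ih β).1 (by simpa using h2)⟩
      · rintro ⟨rfl, h2⟩
        exact ⟨⟨fun _ => by simp, fun h => by omega, fun h => by omega⟩,
          by rw [sub_zero]; exact (ih β).2 h2⟩

theorem EntryCond.le {s a b : ℤ} (ha : 0 < a) (h : EntryCond s a b) : b ≤ a := by
  obtain ⟨h1, h2, h3⟩ := h
  rcases lt_trichotomy s a with h | h | h
  · have := h1 h; omega
  · have := h2 h.symm; omega
  · have := h3 h; omega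

/-- A part of α can be cancelled completely only in case (b), when it equals the remaining total;
nothing then remains for later entries. -/
theorem EntryCond.eq_of_eq {s a : ℤ} (ha : 0 < a) (h : EntryCond s a a) : s = a := by
  obtain ⟨h1, h2, h3⟩ := h
  rcases lt_trichotomy s a with h | h | h
  · have := h1 h; omega
  · exact h
  · have := h3 h; omega

theorem reduced_cons_of_ne {a : ℕ+} {b : ℤ} (h : b ≠ a) (α : Comp) (β : List ℤ) :
    reduced (a :: α) (b :: β) = ((a : ℤ) - b) :: reduced α β := by
  have : (a : ℤ) - b ≠ 0 := by omega
  simp [reduced, toInts_cons, this]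

theorem reduced_cons_self (a : ℕ+) (α : Comp) (β : List ℤ) :
    reduced (a :: α) ((a : ℤ) :: β) = reduced α β := by
  simp [reduced, toInts_cons]

theorem reduced_replicate (α : Comp) :
    reduced α (List.replicate α.length 0) = toInts α := by
  induction α with
  | nil => rfl
  | cons a α ih =>
    have ha : (0 : ℤ) < (a : ℤ) := by exact_mod_cast a.pos
    rw [List.length_cons, List.replicate_succ, reduced_cons_of_ne (by omega), ih, sub_zero,
      toInts_cons]

theorem MemZ.reduced_pos {s : ℤ} {α : Comp} {β : List ℤ} (h : MemZ s α β) :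
    ∀ x ∈ reduced α β, 0 < x := by
  induction α generalizing s β with
  | nil => simp [reduced, toInts]
  | cons a α ih => cases β with
    | nil => exact h.elim
    | cons b β =>
      have hle := h.1.le (by exact_mod_cast a.pos)
      by_cases hb : b = a
      · rw [hb, reduced_cons_self]; exact ih h.2
      · rw [reduced_cons_of_ne hb]
        intro x hx
        rcases List.mem_cons.1 hx with rfl | hx
        · omega
        · exact ih h.2 x hx

theorem MemZ.sum_reduced {s : ℤ} {α : Comp} {β : List ℤ} (h : MemZ s α β) :
    (reduced α β).sum = size α - s := by
  induction α generalizing s β with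
  | nil => cases β with
    | nil => have : s = 0 := h; simp [reduced, toInts, size_nil, this]
    | cons b β => exact h.elim
  | cons a α ih => cases β with
    | nil => exact h.elim
    | cons b β =>
      have := ih h.2
      rw [size_cons]
      push_cast
      by_cases hb : b = a
      · rw [hb] at this ⊢
        rw [reduced_cons_self, this]; ring
      · rw [reduced_cons_of_ne hb, List.sum_cons, this]; ring

/-- The composition with the given parts (meaningful for tuples of positive integers). -/
def ofInts (l : List ℤ) : Comp := l.map fun z => z.toNat.toPNat'

theorem toInts_ofInts {l : List ℤ} (h : ∀ x ∈ l, 0 < x) : toInts (ofInts l) = l := by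
  induction l with
  | nil => rfl
  | cons x l ih =>
    have hx := h x (by simp)
    have h1 : toInts (ofInts (x :: l)) = ((x.toNat.toPNat' : ℕ) : ℤ) :: toInts (ofInts l) := rfl
    rw [h1, ih fun y hy => h y (by simp [hy]), Nat.toPNat'_coe, if_pos (by omega)]
    congr 1
    omega

theorem MemZ.le_size {s : ℤ} {α : Comp} {β : List ℤ} (h : MemZ s α β) : s ≤ size α := by
  have h1 := h.sum_reduced
  have h2 : 0 ≤ (reduced α β).sum := List.sum_nonneg fun x hx => (h.reduced_pos x hx).le
  omega

/-- The members of `Z_{s,α}`, as a finite set defined by recursion. -/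
def zFinset : Comp → ℕ → Finset (List ℤ)
  | [], s => if s = 0 then {[]} else ∅
  | a :: α, s =>
    if s < a then
      (Finset.range (s + 1)).biUnion fun j => (zFinset α (s - j)).image (List.cons (j : ℤ))
    else
      -- By `MemZ.le_size` the new total s + 1 + j is at most `size α`, so the bound on j loses no
      -- vector.
      ((Finset.range (size α)).biUnion fun j =>
        (zFinset α (s + 1 + j)).image (List.cons (-(j + 1 : ℤ)))) ∪
      if (a : ℕ) = s then {(a : ℤ) :: List.replicate α.length 0} else ∅

theorem mem_zFinset {α : Comp} {s : ℕ} {β : List ℤ} : β ∈ zFinset α s ↔ MemZ s α β := by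
  induction α generalizing s β with
  | nil =>
    cases β with
    | nil =>
      have : MemZ s [] [] ↔ (s : ℤ) = 0 := Iff.rfl
      rw [this, zFinset]
      by_cases h : s = 0 <;> simp [h]
    | cons b β =>
      have : MemZ s [] (b :: β) ↔ False := Iff.rfl
      rw [this, zFinset]
      by_cases h : s = 0 <;> simp [h]
  | cons a α ih =>
    have ha := a.pos
    cases β with
    | nil =>
      have : MemZ s (a :: α) [] ↔ False := Iff.rfl
      rw [this, zFinset]
      split_ifs <;> simp
    | cons b β =>
      have : MemZ s (a :: α) (b :: β) ↔ EntryCond s a b ∧ MemZ (s - b) α β := Iff.rfl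
      rw [this, zFinset]
      have ea : (a : ℤ) = ((a : ℕ) : ℤ) := rfl
      split_ifs with h1 h2
      · simp only [Finset.mem_biUnion, Finset.mem_range, Finset.mem_image, List.cons.injEq]
        constructor
        · rintro ⟨j, hj, β', hβ, rfl, rfl⟩
          rw [ih] at hβ
          refine ⟨⟨by omega, by omega, by omega⟩, ?_⟩
          rwa [Nat.cast_sub (by omega)] at hβ
        · rintro ⟨hb, hβ⟩
          have := hb.1 (by omega)
          refine ⟨b.toNat, by omega, β, ?_, by omega, rfl⟩
          rw [ih]
          convert hβ using 1
          omega
      · simp only [Finset.mem_union, Finset.mem_biUnion, Finset.mem_range, Finset.mem_image,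
          List.cons.injEq, Finset.mem_singleton]
        constructor
        · rintro (⟨j, hj, β', hβ, rfl, rfl⟩ | ⟨rfl, hβ⟩)
          · rw [ih] at hβ
            refine ⟨⟨by omega, by omega, by omega⟩, ?_⟩
            convert hβ using 1
            push_cast
            ring
          · refine ⟨⟨by omega, by omega, by omega⟩, ?_⟩
            rw [ea, h2, sub_self, memZ_zero]
            exact hβ
        · rintro ⟨hb, hβ⟩
          rcases hb.2.1 (by omega) with hb' | hb'
          · right
            refine ⟨hb', ?_⟩
            rw [hb', ea, h2, sub_self, memZ_zero] at hβ
            exact hβ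
          · left
            have := hβ.le_size
            refine ⟨(-b - 1).toNat, by omega, β, ?_, by omega, rfl⟩
            rw [ih]
            convert hβ using 1
            push_cast
            omega
      · simp only [Finset.mem_union, Finset.mem_biUnion, Finset.mem_range, Finset.mem_image,
          List.cons.injEq, Finset.notMem_empty, or_false]
        constructor
        · rintro ⟨j, hj, β', hβ, rfl, rfl⟩
          rw [ih] at hβ
          refine ⟨⟨by omega, by omega, by omega⟩, ?_⟩
          convert hβ using 1
          push_cast
          ring
        · rintro ⟨hb, hβ⟩
          have hb' := hb.2.2 (by omega)
          have := hβ.le_size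
          refine ⟨(-b - 1).toNat, by omega, β, ?_, by omega, rfl⟩
          rw [ih]
          convert hβ using 1
          push_cast
          omega

theorem sgn_cons_of_nonneg {b : ℤ} (h : 0 ≤ b) (β : List ℤ) : sgn (b :: β) = sgn β := by
  simp [sgn, h]

theorem sgn_cons_of_neg {b : ℤ} (h : b < 0) (β : List ℤ) : sgn (b :: β) = -sgn β := by
  simp [sgn, h, pow_succ]

theorem sgn_replicate (n : ℕ) : sgn (List.replicate n 0) = 1 := by
  induction n with
  | zero => rfl
  | succ n ih => rw [List.replicate_succ, sgn_cons_of_nonneg le_rfl, ih]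

/-- The signed sum over a set of vectors whose first entries are given by an injective
function of an index. -/
theorem sum_biUnion_cons {A : Type*} [AddCommMonoid A] (S : Finset ℕ)
    (T : ℕ → Finset (List ℤ)) {f : ℕ → ℤ} (hf : Function.Injective f) (g : List ℤ → A) :
    ∑ β ∈ S.biUnion fun j => (T j).image (List.cons (f j)), g β =
      ∑ j ∈ S, ∑ β ∈ T j, g (f j :: β) := by
  rw [Finset.sum_biUnion]
  · refine Finset.sum_congr rfl fun j _ => ?_
    rw [Finset.sum_image]
    exact fun _ _ _ _ h => List.cons_injective h
  · intro i _ j _ hij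
    rw [Function.onFun, Finset.disjoint_left]
    intro β h1 h2
    obtain ⟨x, _, rfl⟩ := Finset.mem_image.1 h1
    obtain ⟨y, _, h⟩ := Finset.mem_image.1 h2
    exact hij (hf (List.cons.inj h).1.symm)

/-! ### The expansion of F_s^⊥ 𝔖_α along the recursion -/

theorem immaculate_cons (a : ℕ+) (α : Comp) :
    immaculate (a :: α) = bernstein a (immaculate α) := rfl

theorem immaculateZ_cons (a : ℤ) (l : List ℤ) :
    immaculateZ (a :: l) = bernstein a (immaculateZ l) := rfl

theorem immaculate_nil : immaculate [] = 1 := rfl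

theorem zFinset_eq_empty {α : Comp} {s : ℕ} (h : size α < s) : zFinset α s = ∅ := by
  refine Finset.eq_empty_of_forall_notMem fun β hβ => ?_
  have := (mem_zFinset.1 hβ).le_size
  omega

/-- Induction on the parts. For s < a, `rowPerp_bernstein` supplies the first entries 0, …, s; for s
≥ a, `sum_bernstein_rowPerp` trades that sum for minus its complement, which supplies the negative
entries with their sign. -/
theorem rowPerp_immaculate (s : ℕ) (α : Comp) : rowPerp s (immaculate α) =
    ∑ β ∈ zFinset α s, sgn β • immaculateZ (reduced α β) := by
  induction α generalizing s with
  | nil =>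
    rw [zFinset, immaculate_nil]
    cases s with
    | zero => simp [rowPerp_zero, sgn, reduced, toInts, immaculateZ]
    | succ s => simp [rowPerp_succ_one]
  | cons a α ih =>
    have ea : (a : ℤ) = ((a : ℕ) : ℤ) := rfl
    rw [immaculate_cons, zFinset]
    split_ifs with h1 h2
    · rw [rowPerp_bernstein, sum_biUnion_cons _ _ Nat.cast_injective]
      refine Finset.sum_congr rfl fun j hj => ?_
      have hj := Finset.mem_range.1 hj
      rw [ih, bernstein_sum]
      refine Finset.sum_congr rfl fun β _ => ?_
      rw [bernstein_zsmul, sgn_cons_of_nonneg (by omega), reduced_cons_of_ne (by omega),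
        immaculateZ_cons]
    all_goals
      have hz : ∀ t, s + 1 + size α ≤ t → rowPerp t (immaculate α) = 0 := fun t ht => by
        rw [ih, zFinset_eq_empty (by omega), Finset.sum_empty]
      -- With index a - s, the terms t ≤ s read backwards are those of `rowPerp_bernstein`; the
      -- terms t = s + 1 + j belong to the entries -(j + 1).
      have hB := sum_bernstein_rowPerp hz ((a : ℤ) - s)
      rw [Finset.sum_range_add, ← Finset.sum_range_reflect] at hB
      have e1 : ∑ j ∈ Finset.range (s + 1), bernstein ((a : ℤ) - s + ((s + 1 - 1 - j : ℕ) : ℤ))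
          (rowPerp (s + 1 - 1 - j) (immaculate α)) = rowPerp s (bernstein a (immaculate α)) := by
        rw [rowPerp_bernstein]
        refine Finset.sum_congr rfl fun j hj => ?_
        have hj := Finset.mem_range.1 hj
        rw [Nat.add_sub_cancel]
        congr 1
        omega
      have hinj : Function.Injective fun j : ℕ => (-(j + 1 : ℤ)) := fun i j h => by
        simpa using h
      have e2 : ∑ β ∈ (Finset.range (size α)).biUnion fun j =>
            (zFinset α (s + 1 + j)).image (List.cons (-(j + 1 : ℤ))),
            sgn β • immaculateZ (reduced (a :: α) β) =
          -∑ j ∈ Finset.range (size α), bernstein ((a : ℤ) - s + ((s + 1 + j : ℕ) : ℤ))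
            (rowPerp (s + 1 + j) (immaculate α)) := by
        rw [sum_biUnion_cons _ _ hinj, ← Finset.sum_neg_distrib]
        refine Finset.sum_congr rfl fun j _ => ?_
        rw [ih, bernstein_sum, ← Finset.sum_neg_distrib]
        refine Finset.sum_congr rfl fun β _ => ?_
        have ha := a.pos
        rw [bernstein_zsmul, sgn_cons_of_neg (by omega), reduced_cons_of_ne (by omega),
          immaculateZ_cons, neg_smul]
        congr 3
        push_cast
        ring
      rw [e1] at hB
    -- Here a = s and H_0 = 1: the extra summand 𝔖_α comes from the vector (a, 0, …, 0).
    · rw [Finset.sum_union, e2, Finset.sum_singleton, ← sub_eq_iff_eq_add.2 hB.symm,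
        sgn_cons_of_nonneg (by omega), sgn_replicate, reduced_cons_self, reduced_replicate, ea, h2,
        sub_self, H_zero, one_mul, one_smul, sub_eq_neg_add]
      · rfl
      · rw [Finset.disjoint_singleton_right]
        intro h
        simp only [Finset.mem_biUnion, Finset.mem_image, List.cons.injEq] at h
        obtain ⟨j, _, β, _, h, _⟩ := h
        omega
    -- Here a < s, so H_{a-s} = 0 and only the complementary sum remains.
    · rw [Finset.union_empty, e2, eq_neg_iff_add_eq_zero, hB, H_of_neg (by omega), zero_mul]

/-! ### Equivalence of the recursion with (Z1)–(Z3) -/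

theorem entry_cons_one (a : ℤ) (l : List ℤ) : entry (a :: l) 1 = a := rfl

/-- The bound on i is needed: by truncated subtraction, `entry` reads the first entry at index 0 as
well as at index 1. -/
theorem entry_cons_succ {i : ℕ} (hi : 1 ≤ i) (a : ℤ) (l : List ℤ) :
    entry (a :: l) (i + 1) = entry l i := by
  obtain ⟨j, rfl⟩ := Nat.exists_eq_add_of_le' hi
  simp [entry]

theorem take_cons_pred {i : ℕ} (hi : 1 ≤ i) (b : ℤ) (β : List ℤ) :
    (b :: β).take (i + 1 - 1) = b :: β.take (i - 1) := by
  obtain ⟨j, rfl⟩ := Nat.exists_eq_add_of_le' hi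
  simp

theorem z3_cons {s a b : ℤ} {l β : List ℤ} : Z3 s (a :: l) (b :: β) ↔
    ((s < a → 0 ≤ b ∧ b ≤ s) ∧
      (a = s → (b = a ∧ ∀ j, 1 ≤ j → j ≤ l.length → entry β j = 0) ∨ b < 0) ∧
      (a < s → b < 0)) ∧ Z3 (s - b) l β := by
  have htail (i : ℕ) (hi : 1 ≤ i) : (∀ j, i + 1 < j → j ≤ (a :: l).length →
      entry (b :: β) j = 0) ↔ ∀ j, i < j → j ≤ l.length → entry β j = 0 := by
    constructor
    · intro h j h1 h2
      rw [← entry_cons_succ (by omega) b]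
      exact h (j + 1) (by omega) (by simpa using h2)
    · intro h j h1 h2
      obtain ⟨q, rfl⟩ : ∃ q, j = q + 1 := ⟨j - 1, by omega⟩
      rw [entry_cons_succ (by omega)]
      exact h q (by omega) (by simpa using h2)
  have htail' : (∀ j, 1 < j → j ≤ (a :: l).length →
      entry (b :: β) j = 0) ↔ ∀ j, 1 ≤ j → j ≤ l.length → entry β j = 0 := by
    constructor
    · intro h j h1 h2
      rw [← entry_cons_succ h1 b]
      exact h (j + 1) (by omega) (by simpa using h2)
    · intro h j h1 h2
      obtain ⟨q, rfl⟩ : ∃ q, j = q + 1 := ⟨j - 1, by omega⟩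
      rw [entry_cons_succ (by omega)]
      exact h q (by omega) (by simpa using h2)
  constructor
  · intro h
    refine ⟨?_, fun i h1 h2 => ?_⟩
    · have := h 1 le_rfl (by simp)
      rw [htail', entry_cons_one, entry_cons_one] at this
      simpa using this
    · have := h (i + 1) (by omega) (by simpa using h2)
      rw [htail i h1, entry_cons_succ h1, entry_cons_succ h1, take_cons_pred h1, List.sum_cons,
        ← sub_sub] at this
      exact this
  · rintro ⟨h0, h⟩ i h1 h2
    rcases Nat.lt_or_ge 1 i with h3 | h3
    · obtain ⟨q, rfl⟩ : ∃ q, i = q + 1 := ⟨i - 1, by omega⟩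
      have h4 : 1 ≤ q := by omega
      rw [htail q h4, entry_cons_succ h4, entry_cons_succ h4, take_cons_pred h4, List.sum_cons,
        ← sub_sub]
      exact h q h4 (by simpa using h2)
    · obtain rfl : i = 1 := by omega
      rw [htail', entry_cons_one, entry_cons_one]
      simpa using h0

/-- The total and (Z3) suffice. The clause of (b) about later zeros may be dropped, since
`memZ_zero` recovers it. -/
theorem memZ_of_z3 {s : ℤ} {α : Comp} {β : List ℤ} (hl : β.length = α.length)
    (hs : β.sum = s) (h : Z3 s (toInts α) β) : MemZ s α β := by
  induction α generalizing s β with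
  | nil => cases β with
    | nil => exact Eq.symm hs
    | cons b β => simp at hl
  | cons a α ih => cases β with
    | nil => simp at hl
    | cons b β =>
      rw [toInts_cons, z3_cons] at h
      rw [List.sum_cons] at hs
      refine ⟨⟨h.1.1, fun he => (h.1.2.1 he).imp_left And.left, h.1.2.2⟩, ih (by simpa using hl)
        (by omega) h.2⟩

theorem entry_replicate_zero (n j : ℕ) : entry (List.replicate n 0) j = 0 := by
  simp only [entry, List.getD_eq_getElem?_getD, List.getElem?_replicate]
  split_ifs <;> rfl

theorem MemZ.z3 {s : ℤ} {α : Comp} {β : List ℤ} (h : MemZ s α β) : Z3 s (toInts α) β := by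
  induction α generalizing s β with
  | nil => intro i h1 h2; simp [toInts] at h2; omega
  | cons a α ih => cases β with
    | nil => exact h.elim
    | cons b β =>
      rw [toInts_cons, z3_cons]
      refine ⟨⟨h.1.1, fun he => (h.1.2.1 he).imp_left fun hb => ⟨hb, fun j _ _ => ?_⟩, h.1.2.2⟩,
        ih h.2⟩
      have h2 := h.2
      rw [hb, he, sub_self, memZ_zero] at h2
      rw [h2, entry_replicate_zero]

theorem MemZ.sum_take_le {s : ℤ} {α : Comp} {β : List ℤ} (h : MemZ s α β) (i : ℕ) :
    (β.take i).sum ≤ s := by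
  induction α generalizing s β i with
  | nil => cases β with
    | nil => simpa using h.nonneg
    | cons b β => exact h.elim
  | cons a α ih => cases β with
    | nil => exact h.elim
    | cons b β => cases i with
      | zero => simpa using h.nonneg
      | succ i =>
        have := ih h.2 i
        rw [List.take_succ_cons, List.sum_cons]
        omega

theorem entry_toInts_pos {α : Comp} {i : ℕ} (h1 : 1 ≤ i) (h2 : i ≤ α.length) :
    0 < entry (toInts α) i := by
  have h : i - 1 < (toInts α).length := by rw [toInts_length]; omega
  rw [entry, List.getD_eq_getElem _ _ h]
  simp [toInts]

/-- If one entry of α - β vanishes, all later entries of β are 0 while the parts of α are positive,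
so no second one vanishes. -/
theorem MemZ.z2 {s : ℤ} {α : Comp} {β : List ℤ} (h : MemZ s α β) : Z2 (toInts α) β := by
  induction α generalizing s β with
  | nil =>
    refine ⟨fun i h1 h2 => ?_, fun i j h1 h2 => ?_⟩ <;>
    · simp [toInts] at h2; omega
  | cons a α ih => cases β with
    | nil => exact h.elim
    | cons b β =>
      have hle := h.1.le (by exact_mod_cast a.pos)
      have ih := ih h.2
      have key : ∀ j, 1 ≤ j → j ≤ α.length → (a : ℤ) - b = 0 →
          entry (toInts α) j - entry β j ≠ 0 := by
        intro j h1 h2 hab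
        obtain rfl : b = a := by omega
        have h0 := h.1.eq_of_eq (by exact_mod_cast a.pos)
        have h3 := h.2
        rw [h0, sub_self, memZ_zero] at h3
        rw [h3, entry_replicate_zero, sub_zero]
        exact (entry_toInts_pos h1 h2).ne'
      rw [toInts_cons]
      refine ⟨fun i h1 h2 => ?_, fun i j h1 h2 h3 h4 h5 h6 => ?_⟩
      · rcases Nat.lt_or_ge 1 i with h3 | h3
        · obtain ⟨q, rfl⟩ : ∃ q, i = q + 1 := ⟨i - 1, by omega⟩
          rw [entry_cons_succ (by omega), entry_cons_succ (by omega)]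
          exact ih.1 q (by omega) (by simpa using h2)
        · obtain rfl : i = 1 := by omega
          rw [entry_cons_one, entry_cons_one]
          omega
      · simp only [List.length_cons, toInts_length] at h2 h4
        obtain ⟨p, rfl⟩ := Nat.exists_eq_add_of_le' h1
        obtain ⟨q, rfl⟩ := Nat.exists_eq_add_of_le' h3
        rcases p with _ | p <;> rcases q with _ | q
        · rfl
        · rw [zero_add, entry_cons_one, entry_cons_one] at h5
          rw [entry_cons_succ (by omega), entry_cons_succ (by omega)] at h6
          exact absurd h6 (key _ (by omega) (by omega) h5)
        · rw [zero_add, entry_cons_one, entry_cons_one] at h6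
          rw [entry_cons_succ (by omega), entry_cons_succ (by omega)] at h5
          exact absurd h5 (key _ (by omega) (by omega) h6)
        · rw [entry_cons_succ (by omega), entry_cons_succ (by omega)] at h5 h6
          rw [ih.2 (p + 1) (q + 1) (by omega) (by rw [toInts_length]; omega) (by omega)
            (by rw [toInts_length]; omega) h5 h6]

theorem mem_ZSet_iff {s : ℕ+} {α : Comp} {β : List ℤ} : β ∈ ZSet s α ↔ MemZ s α β :=
  ⟨fun h => memZ_of_z3 h.1 h.2.1.1 h.2.2.2,
    fun h => ⟨h.length_eq, ⟨h.sum_eq, fun i _ _ => h.sum_take_le i⟩, h.z2, h.z3⟩⟩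

theorem mem_ZFiber_iff {s : ℕ+} {α γ : Comp} {β : List ℤ} :
    β ∈ ZFiber s α γ ↔ MemZ s α β ∧ reduced α β = toInts γ :=
  and_congr_left' mem_ZSet_iff

/-! ### The expansion indexed by compositions, and left multiplication by H_s -/

theorem perp_F_immaculate (s : ℕ+) (α : Comp) : perp (F [s]) (immaculate α) =
    ∑ γ ∈ compsOf ((size α : ℤ) - (s : ℤ)), coeff s α γ • immaculate γ := by
  have es : (((s : ℕ) : ℤ)) = (s : ℤ) := rfl
  have h0 := rowPerp_immaculate s α
  rw [rowPerp, rowF_pnat] at h0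
  -- The vectors β are collected according to the composition left by α - β; each fibre contributes
  -- one coefficient.
  rw [h0, ← Finset.sum_fiberwise_of_maps_to (g := fun β => ofInts (reduced α β))
    (t := compsOf ((size α : ℤ) - (s : ℤ)))]
  · refine Finset.sum_congr rfl fun γ _ => ?_
    rw [coeff, Finset.sum_smul]
    have hset : (finite_ZFiber s α γ).toFinset =
        (zFinset α s).filter fun β => ofInts (reduced α β) = γ := by
      ext β
      rw [Set.Finite.mem_toFinset, mem_ZFiber_iff, Finset.mem_filter, mem_zFinset]
      refine and_congr_right fun h => ?_
      rw [← toInts_injective.eq_iff, toInts_ofInts h.reduced_pos]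
    rw [hset]
    refine Finset.sum_congr rfl fun β hβ => ?_
    rw [Finset.mem_filter, mem_zFinset] at hβ
    rw [immaculate, ← hβ.2, toInts_ofInts hβ.1.reduced_pos]
  · intro β hβ
    rw [mem_zFinset] at hβ
    rw [mem_compsOf, ← sum_toInts, toInts_ofInts hβ.reduced_pos, hβ.sum_reduced, es]

theorem H_mul_immaculate (s : ℕ+) (α : Comp) : H (s : ℤ) * immaculate α = immaculate (s :: α) +
    ∑ i ∈ Finset.range (size α), ∑ γ ∈ compsOf ((size α : ℤ) - ((i + 1 : ℕ) : ℤ)),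
      coeff i.succPNat α γ • immaculate ((s + i.succPNat) :: γ) := by
  have hz : ∀ t, size α + 1 ≤ t → rowPerp t (immaculate α) = 0 := fun t ht => by
    rw [rowPerp_immaculate, zFinset_eq_empty (by omega), Finset.sum_empty]
  -- The term t = 0 is 𝔹_s 𝔖_α, the leading summand; the others use the expansion of F_t^⊥ with t =
  -- i + 1.
  rw [← sum_bernstein_rowPerp hz, Finset.sum_range_succ', add_comm, Nat.cast_zero, add_zero,
    rowPerp_zero, ← immaculate_cons]
  congr 1
  refine Finset.sum_congr rfl fun i _ => ?_
  have h := perp_F_immaculate i.succPNat α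
  rw [← rowF_pnat] at h
  have h' : rowPerp (i + 1) (immaculate α) =
    ∑ γ ∈ compsOf ((size α : ℤ) - ((i + 1 : ℕ) : ℤ)), coeff i.succPNat α γ • immaculate γ := h
  rw [h', bernstein_sum]
  refine Finset.sum_congr rfl fun γ _ => ?_
  rw [bernstein_zsmul, immaculate_cons]
  congr 2

/-! ### The immaculate basis and its dual -/

/-- The left Pieri rule keeps H_a 𝔖_γ inside the span of immaculate functions of size a + |γ|, so
factors can be added one at a time. -/
theorem HH_mem_span_immaculate (α : Comp) :
    HH α ∈ Submodule.span ℚ {x | ∃ γ, size γ = size α ∧ x = immaculate γ} := by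
  induction α with
  | nil => exact Submodule.subset_span ⟨[], rfl, rfl⟩
  | cons a α ih =>
    have hle : Submodule.span ℚ {x | ∃ γ, size γ = size α ∧ x = immaculate γ} ≤
        (Submodule.span ℚ {x | ∃ γ, size γ = size (a :: α) ∧ x = immaculate γ}).comap
          (LinearMap.mulLeft ℚ (H (a : ℤ))) := by
      refine Submodule.span_le.2 ?_
      rintro _ ⟨γ, hγ, rfl⟩
      rw [SetLike.mem_coe, Submodule.mem_comap, LinearMap.mulLeft_apply, H_mul_immaculate]
      refine add_mem (Submodule.subset_span ⟨a :: γ, by rw [size_cons, size_cons, hγ], rfl⟩)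
        (sum_mem fun i _ => sum_mem fun δ hδ => zsmul_mem (Submodule.subset_span ?_) _)
      refine ⟨_, ?_, rfl⟩
      rw [mem_compsOf] at hδ
      rw [size_cons, size_cons, PNat.add_coe, Nat.succPNat_coe]
      omega
    rw [HH_cons]
    exact hle ih

/-- Dimension count: the finitely many H_γ with |γ| ≤ N are independent and lie in the span of
equally many immaculate functions. -/
theorem linearIndependent_immaculate_of_size_le (N : ℕ) :
    LinearIndependent ℚ fun γ : {γ : Comp // size γ ≤ N} => immaculate γ := by
  have hfin : {γ : Comp | size γ ≤ N}.Finite := by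
    refine ((Finset.range (N + 1)).biUnion fun n => compsOf n).finite_toSet.subset fun γ hγ => ?_
    simp only [Finset.coe_biUnion, Set.mem_iUnion, Finset.mem_coe, Finset.mem_range, mem_compsOf]
    exact ⟨size γ, Nat.lt_succ_of_le hγ, rfl⟩
  have : Fintype {γ : Comp // size γ ≤ N} := hfin.fintype
  have hH : LinearIndependent ℚ fun γ : {γ : Comp // size γ ≤ N} => HH γ := by
    have := HBasis.linearIndependent.comp (Subtype.val : {γ : Comp // size γ ≤ N} → Comp)
      Subtype.val_injective
    convert this using 2
    exact (HBasis_apply _).symm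
  have hle : Submodule.span ℚ (Set.range fun γ : {γ : Comp // size γ ≤ N} => HH γ) ≤
      Submodule.span ℚ (Set.range fun γ : {γ : Comp // size γ ≤ N} => immaculate γ) := by
    refine Submodule.span_le.2 ?_
    rintro _ ⟨γ, rfl⟩
    refine Submodule.span_mono ?_ (HH_mem_span_immaculate γ)
    rintro _ ⟨δ, hδ, rfl⟩
    exact ⟨⟨δ, hδ.trans_le γ.2⟩, rfl⟩
  have : FiniteDimensional ℚ
      (Submodule.span ℚ (Set.range fun γ : {γ : Comp // size γ ≤ N} => immaculate γ)) :=
    FiniteDimensional.span_of_finite ℚ (Set.finite_range _)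
  rw [linearIndependent_iff_card_le_finrank_span]
  rw [linearIndependent_iff_card_eq_finrank_span] at hH
  rw [hH]
  exact Submodule.finrank_mono hle

theorem linearIndependent_immaculate : LinearIndependent ℚ immaculate := by
  rw [linearIndependent_iff_finset_linearIndependent]
  intro S
  refine (linearIndependent_immaculate_of_size_le (S.sup size)).comp
    (fun γ : S => ⟨γ.1, Finset.le_sup γ.2⟩) fun x y h => ?_
  exact Subtype.ext (Subtype.mk.inj h)

/-- The immaculate basis of `NSym`. -/
def immaculateBasis : Module.Basis Comp ℚ NSym :=
  Module.Basis.mk linearIndependent_immaculate <| by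
    rw [← HBasis.span_eq]
    refine Submodule.span_le.2 ?_
    rintro _ ⟨α, rfl⟩
    rw [HBasis_apply]
    refine Submodule.span_mono ?_ (HH_mem_span_immaculate α)
    rintro _ ⟨γ, -, rfl⟩
    exact ⟨γ, rfl⟩

theorem immaculateBasis_apply (α : Comp) : immaculateBasis α = immaculate α :=
  Module.Basis.mk_apply _ _ α

theorem coord_immaculate (α β : Comp) :
    immaculateBasis.coord β (immaculate α) = if α = β then 1 else 0 := by
  rw [← immaculateBasis_apply, Module.Basis.coord_apply, Module.Basis.repr_self,
    Finsupp.single_apply]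

/-- The dual immaculate function `𝔖^*_β`. -/
def dualImmaculate (β : Comp) : QSym :=
  ⟨immaculateBasis.coord β, size β, fun α h => by
    have hle : Submodule.span ℚ {x | ∃ γ, size γ = size α ∧ x = immaculate γ} ≤
        LinearMap.ker (immaculateBasis.coord β) := by
      refine Submodule.span_le.2 ?_
      rintro _ ⟨γ, hγ, rfl⟩
      rw [SetLike.mem_coe, LinearMap.mem_ker, coord_immaculate, if_neg]
      rintro rfl
      omega
    exact hle (HH_mem_span_immaculate α)⟩

theorem isDualImmaculate_dualImmaculate : IsDualImmaculate dualImmaculate :=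
  fun α β => coord_immaculate α β

/-- Quasi-symmetric functions are determined by their pairing with immaculate functions. -/
theorem eq_of_pairing_immaculate {F G : QSym}
    (h : ∀ α, pairing (immaculate α) F = pairing (immaculate α) G) : F = G :=
  Subtype.ext <| immaculateBasis.ext fun α => by
    rw [immaculateBasis_apply]
    exact h α

theorem existsUnique_isDualImmaculate : ∃! D : Comp → QSym, IsDualImmaculate D :=
  ⟨dualImmaculate, isDualImmaculate_dualImmaculate, fun D hD => funext fun β =>
    eq_of_pairing_immaculate fun α => by rw [hD, isDualImmaculate_dualImmaculate]⟩

theorem pairing_sum_zsmul (x : NSym) (S : Finset Comp) (c : Comp → ℤ) (D : Comp → QSym) :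
    pairing x (∑ β ∈ S, c β • D β) = ∑ β ∈ S, c β • pairing x (D β) := by
  simp only [pairing, AddSubmonoidClass.coe_finsetSum, LinearMap.sum_apply]
  rfl

/-- Paired with 𝔖_β, the left side is the coefficient of 𝔖_α in F_s^⊥ 𝔖_β. -/
theorem F_mul_dualImmaculate (s : ℕ+) (α : Comp) {D : Comp → QSym} (hD : IsDualImmaculate D) :
    F [s] * D α = ∑ β ∈ compsOf ((size α : ℤ) + (s : ℤ)), coeff s β α • D β := by
  refine eq_of_pairing_immaculate fun β => ?_
  rw [← pairing_perp, perp_F_immaculate, pairing_sum_zsmul, pairing, map_sum]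
  have h1 : ∀ γ, (D α : Module.Dual ℚ NSym) (coeff s β γ • immaculate γ) =
      if γ = α then (coeff s β α : ℚ) else 0 := fun γ => by
    rw [map_zsmul]
    have := hD γ α
    rw [pairing] at this
    rw [this]
    split_ifs with h <;> simp [h]
  have h2 : ∀ δ, coeff s δ α • pairing (immaculate β) (D δ) =
      if β = δ then (coeff s β α : ℚ) else 0 := fun δ => by
    rw [hD]
    split_ifs with h <;> simp [h]
  simp only [h1, h2, Finset.sum_ite_eq, Finset.sum_ite_eq', mem_compsOf]
  congr 1
  exact propext ⟨fun h => by omega, fun h => by omega⟩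

/-! ### The signed count of a fibre -/

/-- The fibre `Z^γ_{s,α}`, for an arbitrary integer `s`. -/
def zFiber (s : ℤ) (α γ : Comp) : Set (List ℤ) :=
  {β | MemZ s α β ∧ reduced α β = toInts γ}

/-- The coefficient `c^γ_{s,α}`, for an arbitrary integer `s`. -/
def fiberSum (s : ℤ) (α γ : Comp) : ℤ := ∑ᶠ β ∈ zFiber s α γ, sgn β

theorem finite_zFiber (s : ℤ) (α γ : Comp) : (zFiber s α γ).Finite := by
  refine (zFinset α s.toNat).finite_toSet.subset fun β hβ => ?_
  rw [Finset.mem_coe, mem_zFinset, Int.toNat_of_nonneg hβ.1.nonneg]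
  exact hβ.1

theorem coeff_eq_fiberSum (s : ℕ+) (α γ : Comp) : coeff s α γ = fiberSum s α γ := by
  rw [coeff, fiberSum, ← finsum_mem_coe_finset, Set.Finite.coe_toFinset]
  have : ZFiber s α γ = zFiber s α γ := Set.ext fun β => mem_ZFiber_iff
  rw [this]

theorem sgn_cons (b : ℤ) (β : List ℤ) : sgn (b :: β) = sgn [b] * sgn β := by
  rcases lt_or_ge b 0 with h | h
  · rw [sgn_cons_of_neg h, sgn_cons_of_neg h]; simp [sgn]
  · rw [sgn_cons_of_nonneg h, sgn_cons_of_nonneg h]; simp [sgn]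

theorem sgn_eq_one_or (β : List ℤ) : sgn β = 1 ∨ sgn β = -1 := neg_one_pow_eq_or ℤ _

/-- Either the first entry of α - β vanishes and is deleted, which fixes the rest, or it is the
first part of γ. -/
theorem mem_zFiber_cons {s : ℤ} {a : ℕ+} {α γ : Comp} {β : List ℤ} :
    β ∈ zFiber s (a :: α) γ ↔
      (s = a ∧ γ = α ∧ β = (a : ℤ) :: List.replicate α.length 0) ∨
      ∃ g γ' β', γ = g :: γ' ∧ β = ((a : ℤ) - (g : ℤ)) :: β' ∧ EntryCond s a (a - g) ∧
        β' ∈ zFiber (s - (a - g)) α γ' := by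
  have ha : (0 : ℤ) < (a : ℤ) := by exact_mod_cast a.pos
  constructor
  · rintro ⟨h1, h2⟩
    cases β with
    | nil => exact h1.elim
    | cons b β =>
      obtain ⟨hb, hβ⟩ := h1
      by_cases hab : b = a
      · left
        subst hab
        have hs := hb.eq_of_eq ha
        rw [hs, sub_self, memZ_zero] at hβ
        rw [reduced_cons_self, hβ, reduced_replicate] at h2
        exact ⟨hs, (toInts_injective h2).symm, by rw [hβ]⟩
      · right
        rw [reduced_cons_of_ne hab] at h2
        cases γ with
        | nil => simp [toInts] at h2
        | cons g γ' =>
          rw [toInts_cons, List.cons.injEq] at h2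
          obtain rfl : b = a - g := by omega
          exact ⟨g, γ', β, rfl, rfl, hb, hβ, h2.2⟩
  · rintro (⟨rfl, rfl, rfl⟩ | ⟨g, γ', β', rfl, rfl, hb, hβ, hr⟩)
    · refine ⟨⟨⟨fun h => by omega, fun h => Or.inl rfl, fun h => by omega⟩, ?_⟩, ?_⟩
      · rw [sub_self, memZ_zero]
      · rw [reduced_cons_self, reduced_replicate]
    · have hg : (0 : ℤ) < (g : ℤ) := by exact_mod_cast g.pos
      refine ⟨⟨hb, hβ⟩, ?_⟩
      rw [reduced_cons_of_ne (by omega), hr, toInts_cons, sub_sub_cancel]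

theorem fiberSum_image_cons (b s : ℤ) (α γ : Comp) :
    ∑ᶠ β ∈ List.cons b '' zFiber s α γ, sgn β = sgn [b] * fiberSum s α γ := by
  rw [finsum_mem_image List.cons_injective.injOn, fiberSum,
    mul_finsum_mem]
  exact finsum_mem_congr rfl fun β _ => sgn_cons b β

open Classical in
-- Deleting the first entry would leave `α` itself, so it survives and the first entry of β is
-- forced to be a - g.
theorem fiberSum_cons_of_ne {s : ℤ} {a g : ℕ+} {α γ : Comp} (h : g :: γ ≠ α) :
    fiberSum s (a :: α) (g :: γ) =
      if EntryCond s a (a - g) then sgn [(a : ℤ) - g] * fiberSum (s - (a - g)) α γ else 0 := by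
  split_ifs with hc
  · have : zFiber s (a :: α) (g :: γ) =
        List.cons ((a : ℤ) - g) '' zFiber (s - (a - g)) α γ := by
      ext β
      rw [mem_zFiber_cons]
      constructor
      · rintro (⟨-, h', -⟩ | ⟨g', γ', β', h1, rfl, -, h2⟩)
        · exact absurd h' h
        · obtain ⟨rfl, rfl⟩ := List.cons.inj h1
          exact ⟨β', h2, rfl⟩
      · rintro ⟨β', h2, rfl⟩
        exact Or.inr ⟨g, γ, β', rfl, rfl, hc, h2⟩
    rw [fiberSum, this, fiberSum_image_cons]
  · have : zFiber s (a :: α) (g :: γ) = ∅ := by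
      refine Set.eq_empty_of_forall_notMem fun β hβ => ?_
      rw [mem_zFiber_cons] at hβ
      rcases hβ with ⟨-, h', -⟩ | ⟨g', γ', β', h1, -, h2, -⟩
      · exact h h'
      · obtain ⟨rfl, rfl⟩ := List.cons.inj h1
        exact hc h2
    rw [fiberSum, this, finsum_mem_empty]

theorem entryCond_self_iff (a g : ℕ+) : EntryCond (a : ℤ) a (a - g) ↔ a < g := by
  have hg : (0 : ℤ) < (g : ℤ) := by exact_mod_cast g.pos
  have : a < g ↔ (a : ℤ) < g := by exact_mod_cast Iff.rfl
  rw [this]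
  constructor
  · intro h
    have := h.2.1 rfl
    omega
  · intro h
    exact ⟨fun h' => by omega, fun _ => Or.inr (by omega), fun h' => by omega⟩

theorem fiberSum_singleton (a : ℕ+) : fiberSum (a : ℤ) [a] [] = 1 := by
  have : zFiber (a : ℤ) [a] [] = {[(a : ℤ)]} := by
    ext β
    rw [mem_zFiber_cons]
    simp
  rw [fiberSum, this, finsum_mem_singleton]
  exact sgn_cons_of_nonneg (by positivity) []

/-- Besides (a, 0, …, 0), a vector may begin with a - g; case (b) requires this to be negative. Then
a - (a - g) = g remains, the same situation one place further on with opposite sign. -/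
theorem fiberSum_tail (a g : ℕ+) (γ : Comp) : fiberSum (a : ℤ) (a :: g :: γ) (g :: γ) =
    if a < g then 1 - fiberSum (g : ℤ) (g :: γ) γ else 1 := by
  have ha : (0 : ℤ) < (a : ℤ) := by exact_mod_cast a.pos
  have hg : (0 : ℤ) < (g : ℤ) := by exact_mod_cast g.pos
  have hsgn : sgn ((a : ℤ) :: List.replicate (g :: γ).length 0) = 1 := by
    rw [sgn_cons_of_nonneg ha.le, sgn_replicate]
  split_ifs with h
  · have : zFiber (a : ℤ) (a :: g :: γ) (g :: γ) =
        {(a : ℤ) :: List.replicate (g :: γ).length 0} ∪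
          List.cons ((a : ℤ) - g) '' zFiber (g : ℤ) (g :: γ) γ := by
      ext β
      rw [mem_zFiber_cons, Set.mem_union, Set.mem_singleton_iff]
      refine or_congr ⟨fun h => h.2.2, fun h => ⟨rfl, rfl, h⟩⟩ ?_
      constructor
      · rintro ⟨g', γ', β', h1, rfl, -, h2⟩
        obtain ⟨rfl, rfl⟩ := List.cons.inj h1
        rw [sub_sub_cancel] at h2
        exact ⟨β', h2, rfl⟩
      · rintro ⟨β', h2, rfl⟩
        refine ⟨g, γ, β', rfl, rfl, (entryCond_self_iff a g).2 h, ?_⟩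
        rwa [sub_sub_cancel]
    have hlt : (a : ℤ) < g := by exact_mod_cast h
    rw [fiberSum, this, finsum_mem_union _ (Set.finite_singleton _)
      ((finite_zFiber _ _ _).image _), finsum_mem_singleton, hsgn, fiberSum_image_cons,
      sgn_cons_of_neg (by omega)]
    · simp [sgn, sub_eq_add_neg]
    · rw [Set.disjoint_singleton_left]
      rintro ⟨β', -, h'⟩
      have := (List.cons.inj h').1
      omega
  · have : zFiber (a : ℤ) (a :: g :: γ) (g :: γ) =
        {(a : ℤ) :: List.replicate (g :: γ).length 0} := by
      ext β
      rw [mem_zFiber_cons, Set.mem_singleton_iff]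
      constructor
      · rintro (⟨-, -, h'⟩ | ⟨g', γ', β', h1, -, h2, -⟩)
        · exact h'
        · obtain ⟨rfl, rfl⟩ := List.cons.inj h1
          exact absurd ((entryCond_self_iff a g).1 h2) h
      · exact fun h' => Or.inl ⟨rfl, rfl, h'⟩
    rw [fiberSum, this, finsum_mem_singleton, hsgn]

/-! ### The indices `k` and `r` -/

theorem kIndex_isLeast {α : Comp} (hα : α ≠ []) (γ : Comp) :
    IsLeast {k | 1 ≤ k ∧ k ≤ α.length ∧
      ∀ i, k < i → i ≤ α.length → entry (toInts α) i = entry (toInts γ) (i - 1)}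
      (kIndex α γ) :=
  ⟨Nat.sInf_mem ⟨α.length, List.length_pos_iff.2 hα, le_rfl, fun i h1 h2 => by omega⟩,
    fun _ h => Nat.sInf_le h⟩

theorem one_le_kIndex {α : Comp} (hα : α ≠ []) (γ : Comp) : 1 ≤ kIndex α γ :=
  (kIndex_isLeast hα γ).1.1

theorem kIndex_le_length {α : Comp} (hα : α ≠ []) (γ : Comp) : kIndex α γ ≤ α.length :=
  (kIndex_isLeast hα γ).1.2.1

theorem kIndex_tail (a : ℕ+) (α : Comp) : kIndex (a :: α) α = 1 := by
  refine (kIndex_isLeast (List.cons_ne_nil a α) α).unique ⟨⟨le_rfl, by simp, ?_⟩, fun k h => h.1⟩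
  intro i h1 h2
  obtain ⟨q, rfl⟩ : ∃ q, i = q + 1 := ⟨i - 1, by omega⟩
  rw [toInts_cons, entry_cons_succ (by omega), Nat.add_sub_cancel]

theorem toInts_ext {α γ : Comp} (hl : α.length = γ.length)
    (h : ∀ i, 1 ≤ i → i ≤ α.length → entry (toInts α) i = entry (toInts γ) i) : α = γ := by
  refine toInts_injective (List.ext_getElem (by rw [toInts_length, toInts_length, hl])
    fun i h1 h2 => ?_)
  have := h (i + 1) (by omega) (by rw [toInts_length] at h1; omega)
  rwa [entry, entry, Nat.add_sub_cancel, List.getD_eq_getElem _ _ h1,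
    List.getD_eq_getElem _ _ h2] at this

/-- The value 1 would be admissible only if `g :: γ` were the tail `α`; every other candidate shifts
by one place. -/
theorem kIndex_cons_cons {a g : ℕ+} {α γ : Comp} (hl : γ.length + 1 = α.length)
    (hne : g :: γ ≠ α) : kIndex (a :: α) (g :: γ) = kIndex α γ + 1 := by
  have hα : α ≠ [] := by rintro rfl; simp at hl
  obtain ⟨⟨h1, h2, h3⟩, h4⟩ := kIndex_isLeast hα γ
  refine (kIndex_isLeast (List.cons_ne_nil a α) (g :: γ)).unique
    ⟨⟨by omega, by simpa using h2, fun i hi hi' => ?_⟩, fun q hq => ?_⟩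
  · obtain ⟨j, rfl⟩ : ∃ j, i = j + 1 + 1 := ⟨i - 2, by omega⟩
    have := h3 (j + 1) (by omega) (by simpa using hi')
    rw [toInts_cons, toInts_cons, entry_cons_succ (by omega), Nat.add_sub_cancel, this,
      Nat.add_sub_cancel, entry_cons_succ (by omega)]
  · obtain ⟨hq1, hq2, hq3⟩ := hq
    rcases Nat.lt_or_ge 1 q with hq | hq
    · obtain ⟨p, rfl⟩ : ∃ p, q = p + 1 := ⟨q - 1, by omega⟩
      refine Nat.succ_le_succ (h4 ⟨by omega, by simpa using hq2, fun i hi hi' => ?_⟩)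
      have := hq3 (i + 1) (by omega) (by simpa using hi')
      obtain ⟨j, rfl⟩ : ∃ j, i = j + 1 := ⟨i - 1, by omega⟩
      rwa [toInts_cons, toInts_cons, entry_cons_succ (by omega), Nat.add_sub_cancel,
        entry_cons_succ (by omega)] at this
    · obtain rfl : q = 1 := by omega
      refine absurd (toInts_ext (by simpa using hl.symm) fun i hi hi' => ?_).symm hne
      have := hq3 (i + 1) (by omega) (by simpa using hi')
      rwa [toInts_cons, entry_cons_succ hi, Nat.add_sub_cancel] at this

theorem rIndex_isGreatest {α : Comp} (hα : α ≠ []) (γ : Comp) :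
    IsGreatest {r | kIndex α γ ≤ r ∧ r ≤ α.length ∧
      ∀ i, kIndex α γ ≤ i → i < r → entry (toInts α) i < entry (toInts α) (i + 1)}
      (rIndex α γ) := by
  have hb : BddAbove {r | kIndex α γ ≤ r ∧ r ≤ α.length ∧
      ∀ i, kIndex α γ ≤ i → i < r → entry (toInts α) i < entry (toInts α) (i + 1)} :=
    ⟨α.length, fun r hr => hr.2.1⟩
  exact ⟨Nat.sSup_mem ⟨kIndex α γ, le_rfl, kIndex_le_length hα γ, fun i h1 h2 => by omega⟩ hb,
    fun r hr => le_csSup hb hr⟩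

theorem rIndex_cons_cons {a g : ℕ+} {α γ : Comp} (hl : γ.length + 1 = α.length)
    (hne : g :: γ ≠ α) : rIndex (a :: α) (g :: γ) = rIndex α γ + 1 := by
  have hα : α ≠ [] := by rintro rfl; simp at hl
  have hk := one_le_kIndex hα γ
  obtain ⟨⟨h1, h2, h3⟩, h4⟩ := rIndex_isGreatest hα γ
  refine (rIndex_isGreatest (List.cons_ne_nil a α) (g :: γ)).unique ?_
  rw [kIndex_cons_cons hl hne]
  refine ⟨⟨by omega, by simpa using h2, fun i hi hi' => ?_⟩, fun q hq => ?_⟩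
  · obtain ⟨j, rfl⟩ : ∃ j, i = j + 1 := ⟨i - 1, by omega⟩
    rw [toInts_cons, entry_cons_succ (by omega), entry_cons_succ (by omega)]
    exact h3 j (by omega) (by omega)
  · obtain ⟨hq1, hq2, hq3⟩ := hq
    obtain ⟨p, rfl⟩ : ∃ p, q = p + 1 := ⟨q - 1, by omega⟩
    refine Nat.succ_le_succ (h4 ⟨by omega, by simpa using hq2, fun i hi hi' => ?_⟩)
    have := hq3 (i + 1) (by omega) (by omega)
    rwa [toInts_cons, entry_cons_succ (by omega), entry_cons_succ (by omega)] at this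

theorem rIndex_singleton (a : ℕ+) : rIndex [a] [] = 1 := by
  have h := (rIndex_isGreatest (List.cons_ne_nil a []) []).1
  have h1 := h.1
  have h2 := h.2.1
  rw [kIndex_tail] at h1
  rw [List.length_singleton] at h2
  omega

/-- The increasing run starting at `a` either stops at once or is `a` followed by the run starting
at `g`. -/
theorem rIndex_tail (a g : ℕ+) (γ : Comp) : rIndex (a :: g :: γ) (g :: γ) =
    if a < g then rIndex (g :: γ) γ + 1 else 1 := by
  obtain ⟨⟨h1, h2, h3⟩, h4⟩ := rIndex_isGreatest (List.cons_ne_nil g γ) γ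
  refine (rIndex_isGreatest (List.cons_ne_nil a (g :: γ)) (g :: γ)).unique ?_
  rw [kIndex_tail]
  rw [kIndex_tail] at h1
  simp only [kIndex_tail] at h3 h4
  split_ifs with h
  · have hag : (a : ℤ) < g := by exact_mod_cast h
    refine ⟨⟨by omega, by simpa using h2, fun i hi hi' => ?_⟩, fun q hq => ?_⟩
    · rcases Nat.lt_or_ge 1 i with hi1 | hi1
      · obtain ⟨j, rfl⟩ : ∃ j, i = j + 1 := ⟨i - 1, by omega⟩
        rw [toInts_cons, entry_cons_succ (by omega), entry_cons_succ (by omega)]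
        exact h3 j (by omega) (by omega)
      · obtain rfl : i = 1 := by omega
        exact hag
    · obtain ⟨hq1, hq2, hq3⟩ := hq
      rcases Nat.lt_or_ge 1 q with hq | hq
      · obtain ⟨p, rfl⟩ : ∃ p, q = p + 1 := ⟨q - 1, by omega⟩
        refine Nat.succ_le_succ (h4 ⟨by omega, by simpa using hq2, fun i hi hi' => ?_⟩)
        have := hq3 (i + 1) (by omega) (by omega)
        rwa [toInts_cons a, entry_cons_succ (by omega), entry_cons_succ (by omega)] at this
      · omega
  · refine ⟨⟨le_rfl, by simp, fun i hi hi' => by omega⟩, fun q hq => ?_⟩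
    by_contra hq1
    have h5 : (a : ℤ) < g := hq.2.2 1 le_rfl (by omega)
    exact h (by exact_mod_cast h5)

/-! ### The padded difference vector -/

theorem diff_cons_cons (a g : ℕ+) (α γ : Comp) :
    diff (a :: α) (g :: γ) = ((a : ℤ) - g) :: diff α γ := rfl

theorem headDiff_tail (a : ℕ+) (α : Comp) : headDiff (a :: α) α = [] := by
  rw [headDiff, kIndex_tail, Nat.sub_self, List.take_zero]

theorem paddedDiff_tail (a : ℕ+) (α : Comp) :
    paddedDiff (a :: α) α = (a : ℤ) :: List.replicate α.length 0 := by
  rw [paddedDiff, headDiff_tail, kIndex_tail]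
  rfl

theorem headDiff_cons_cons {a g : ℕ+} {α γ : Comp} (hl : γ.length + 1 = α.length)
    (hne : g :: γ ≠ α) : headDiff (a :: α) (g :: γ) = ((a : ℤ) - g) :: headDiff α γ := by
  have hk := one_le_kIndex (α := α) (by rintro rfl; simp at hl) γ
  obtain ⟨q, hq⟩ := Nat.exists_eq_add_of_le' hk
  rw [headDiff, headDiff, kIndex_cons_cons hl hne, hq, diff_cons_cons, Nat.add_sub_cancel,
    Nat.add_sub_cancel, List.take_succ_cons]

theorem paddedDiff_cons_cons {a g : ℕ+} {α γ : Comp} (hl : γ.length + 1 = α.length)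
    (hne : g :: γ ≠ α) : paddedDiff (a :: α) (g :: γ) = ((a : ℤ) - g) :: paddedDiff α γ := by
  have hk := one_le_kIndex (α := α) (by rintro rfl; simp at hl) γ
  rw [paddedDiff, paddedDiff, headDiff_cons_cons hl hne, kIndex_cons_cons hl hne, toInts_cons,
    entry_cons_succ hk, List.length_cons, Nat.add_sub_add_right, List.cons_append]

/-! ### The values of the coefficients -/

open Classical in
-- Until γ becomes the tail of α, both sides peel off the same forced entry. At that point k = 1,
-- and the recursion 1 - c of `fiberSum_tail` gives 1 or 0 by the parity of the length of the run.
-- The size condition forces s = a there.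
theorem fiberSum_of_length_add_one {s : ℤ} {α γ : Comp} (hl : γ.length + 1 = α.length)
    (hs : (size γ : ℤ) + s = size α) : fiberSum s α γ =
      if Even (rIndex α γ - kIndex α γ) ∧ MemZ s α (paddedDiff α γ) then sgn (headDiff α γ)
      else 0 := by
  induction α generalizing s γ with
  | nil => simp at hl
  | cons a α ih =>
    by_cases hγ : γ = α
    · subst hγ
      obtain rfl : s = a := by
        rw [size_cons] at hs
        push_cast at hs
        exact add_left_cancel (hs.trans (add_comm _ _))
      have hmem : MemZ (a : ℤ) (a :: γ) (paddedDiff (a :: γ) γ) := by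
        rw [paddedDiff_tail]
        exact ((mem_zFiber_cons (γ := γ)).2 (Or.inl ⟨rfl, rfl, rfl⟩)).1
      have hsgn : sgn (headDiff (a :: γ) γ) = 1 := by rw [headDiff_tail]; rfl
      rw [hsgn, kIndex_tail]
      simp only [hmem, and_true]
      cases γ with
      | nil => simp [fiberSum_singleton, rIndex_singleton]
      | cons g γ =>
        have hmem' : MemZ (g : ℤ) (g :: γ) (paddedDiff (g :: γ) γ) := by
          rw [paddedDiff_tail]
          exact ((mem_zFiber_cons (γ := γ)).2 (Or.inl ⟨rfl, rfl, rfl⟩)).1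
        have hsgn' : sgn (headDiff (g :: γ) γ) = 1 := by rw [headDiff_tail]; rfl
        -- Since r ≥ k = 1, the truncated difference r - 1 is exact and its parity is opposite to
        -- that of r.
        have hr := (rIndex_isGreatest (List.cons_ne_nil g γ) γ).1.1
        rw [kIndex_tail] at hr
        rw [fiberSum_tail, rIndex_tail]
        split_ifs with h1 h2 h2
        · rw [ih (by simp) (by rw [size_cons]; push_cast; ring), kIndex_tail, if_neg]
          · rfl
          · rintro ⟨h3, -⟩
            rw [Nat.add_sub_cancel] at h2
            rw [Nat.even_sub hr] at h3
            simp [h2] at h3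
        · rw [ih (by simp) (by rw [size_cons]; push_cast; ring), kIndex_tail, if_pos, hsgn']
          · rfl
          · refine ⟨?_, hmem'⟩
            rw [Nat.add_sub_cancel] at h2
            rw [Nat.even_sub hr]
            simp [h2]
        · rfl
        · simp at h2
    · cases γ with
      | nil =>
        have : α.length = 0 := by simpa using hl
        exact absurd (List.length_eq_zero_iff.1 this).symm hγ
      | cons g γ =>
        have hl' : γ.length + 1 = α.length := by simpa using hl
        rw [fiberSum_cons_of_ne hγ, kIndex_cons_cons hl' hγ, rIndex_cons_cons hl' hγ,
          paddedDiff_cons_cons hl' hγ, headDiff_cons_cons hl' hγ, Nat.add_sub_add_right,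
          sgn_cons _ (headDiff α γ)]
        rw [size_cons, size_cons] at hs
        push_cast at hs
        have ea : (a : ℤ) = ((a : ℕ) : ℤ) := rfl
        have eg : (g : ℤ) = ((g : ℕ) : ℤ) := rfl
        rw [ih hl' (by omega)]
        have hM : MemZ s (a :: α) (((a : ℤ) - g) :: paddedDiff α γ) ↔
            EntryCond s a (a - g) ∧ MemZ (s - (a - g)) α (paddedDiff α γ) := Iff.rfl
        rw [hM]
        by_cases hc : EntryCond s a (a - g) <;> simp [hc]

/-- After a deletion the remaining total is 0, so β continues with zeros and nothing more is
deleted. -/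
theorem MemZ.length_reduced {s : ℤ} {α : Comp} {β : List ℤ} (h : MemZ s α β) :
    (reduced α β).length = α.length ∨ (reduced α β).length + 1 = α.length := by
  induction α generalizing s β with
  | nil => cases β with
    | nil => exact Or.inl rfl
    | cons b β => exact h.elim
  | cons a α ih => cases β with
    | nil => exact h.elim
    | cons b β =>
      obtain ⟨h1, h2⟩ := h
      by_cases hb : b = a
      · subst hb
        rw [h1.eq_of_eq (by exact_mod_cast a.pos), sub_self, memZ_zero] at h2
        rw [reduced_cons_self, h2, reduced_replicate, toInts_length]
        exact Or.inr rfl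
      · rw [reduced_cons_of_ne hb, List.length_cons, List.length_cons]
        have := ih h2
        omega

theorem zipWith_sub_zipWith_sub {l β : List ℤ} (h : β.length = l.length) :
    List.zipWith (fun x y => x - y) l (List.zipWith (fun x y => x - y) l β) = β := by
  induction l generalizing β with
  | nil => rw [List.length_eq_zero_iff.1 h]; rfl
  | cons x l ih => cases β with
    | nil => simp at h
    | cons y β => simp [ih (by simpa using h)]

theorem reduced_diff {α γ : Comp} (hl : γ.length = α.length) :
    reduced α (diff α γ) = toInts γ := by
  rw [reduced, diff, zipWith_sub_zipWith_sub (by rw [toInts_length, toInts_length, hl]),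
    List.filter_eq_self]
  intro x hx
  obtain ⟨g, -, rfl⟩ := List.mem_map.1 hx
  simp

/-- Equal lengths mean that no entry was deleted, so β is recovered from α and γ by subtraction. -/
theorem eq_diff_of_reduced_eq {s : ℤ} {α γ : Comp} {β : List ℤ} (hl : γ.length = α.length)
    (h : MemZ s α β) (hr : reduced α β = toInts γ) : β = diff α γ := by
  have hβ := h.length_eq
  have hz : (List.zipWith (fun x y => x - y) (toInts α) β).length = α.length := by
    simp [toInts_length, hβ]
  have h1 : reduced α β = List.zipWith (fun x y => x - y) (toInts α) β := by
    refine List.filter_sublist.eq_of_length ?_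
    rw [hz, ← hl, ← toInts_length γ, ← hr, reduced]
  rw [diff, ← hr, h1, zipWith_sub_zipWith_sub (by rw [toInts_length, hβ])]

open Classical in
theorem fiberSum_of_length_eq {s : ℤ} {α γ : Comp} (hl : γ.length = α.length) :
    fiberSum s α γ = if MemZ s α (diff α γ) then sgn (diff α γ) else 0 := by
  split_ifs with h
  · have : zFiber s α γ = {diff α γ} := by
      refine Set.eq_singleton_iff_unique_mem.2 ⟨⟨h, reduced_diff hl⟩, ?_⟩
      exact fun β hβ => eq_diff_of_reduced_eq hl hβ.1 hβ.2
    rw [fiberSum, this, finsum_mem_singleton]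
  · have : zFiber s α γ = ∅ := by
      refine Set.eq_empty_of_forall_notMem fun β hβ => h ?_
      rw [← eq_diff_of_reduced_eq hl hβ.1 hβ.2]
      exact hβ.1
    rw [fiberSum, this, finsum_mem_empty]

theorem fiberSum_of_length_ne {s : ℤ} {α γ : Comp} (h1 : γ.length ≠ α.length)
    (h2 : γ.length + 1 ≠ α.length) : fiberSum s α γ = 0 := by
  have : zFiber s α γ = ∅ := by
    refine Set.eq_empty_of_forall_notMem fun β hβ => ?_
    have := hβ.1.length_reduced
    rw [hβ.2, toInts_length] at this
    exact this.elim h1 h2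
  rw [fiberSum, this, finsum_mem_empty]

theorem coeff_values (s : ℕ+) (α : Comp) {γ : Comp}
    (hγ : γ ∈ compsOf ((size α : ℤ) - (s : ℤ))) :
    (γ.length = α.length → diff α γ ∈ ZSet s α → coeff s α γ = sgn (diff α γ)) ∧
    (γ.length + 1 = α.length → Even (rIndex α γ - kIndex α γ) → paddedDiff α γ ∈ ZSet s α →
      coeff s α γ = sgn (headDiff α γ)) ∧
    (¬ (γ.length = α.length ∧ diff α γ ∈ ZSet s α) →
      ¬ (γ.length + 1 = α.length ∧ Even (rIndex α γ - kIndex α γ) ∧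
        paddedDiff α γ ∈ ZSet s α) →
      coeff s α γ = 0) ∧
    (coeff s α γ = 0 ∨ coeff s α γ = 1 ∨ coeff s α γ = -1) := by
  rw [mem_compsOf] at hγ
  have hs : (size γ : ℤ) + (s : ℤ) = size α := by omega
  simp only [mem_ZSet_iff, coeff_eq_fiberSum]
  refine ⟨fun h1 h2 => ?_, fun h1 h2 h3 => ?_, fun h1 h2 => ?_, ?_⟩
  · rw [fiberSum_of_length_eq h1, if_pos h2]
  · rw [fiberSum_of_length_add_one h1 hs, if_pos ⟨h2, h3⟩]
  · by_cases h3 : γ.length = α.length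
    · rw [fiberSum_of_length_eq h3, if_neg fun h => h1 ⟨h3, h⟩]
    · by_cases h4 : γ.length + 1 = α.length
      · rw [fiberSum_of_length_add_one h4 hs, if_neg fun h => h2 ⟨h4, h⟩]
      · exact fiberSum_of_length_ne h3 h4
  · by_cases h3 : γ.length = α.length
    · rw [fiberSum_of_length_eq h3]
      split_ifs
      · exact Or.inr (sgn_eq_one_or _)
      · exact Or.inl rfl
    · by_cases h4 : γ.length + 1 = α.length
      · rw [fiberSum_of_length_add_one h4 hs]
        split_ifs
        · exact Or.inr (sgn_eq_one_or _)
        · exact Or.inl rfl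
      · exact Or.inl (fiberSum_of_length_ne h3 h4)

end Immaculate

end

open Immaculate in
theorem theorem4p3 (s : ℕ+) (α : Comp) :
    -- the expansion of `F_s^⊥ 𝔖_α`
    (perp (F [s]) (immaculate α) =
      ∑ γ ∈ compsOf ((size α : ℤ) - (s : ℤ)), coeff s α γ • immaculate γ) ∧
    -- the values of the coefficients
    (∀ γ ∈ compsOf ((size α : ℤ) - (s : ℤ)),
      (γ.length = α.length → diff α γ ∈ ZSet s α →
        coeff s α γ = sgn (diff α γ)) ∧
      (γ.length + 1 = α.length → Even (rIndex α γ - kIndex α γ) → paddedDiff α γ ∈ ZSet s α →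
        coeff s α γ = sgn (headDiff α γ)) ∧
      (¬ (γ.length = α.length ∧ diff α γ ∈ ZSet s α) →
        ¬ (γ.length + 1 = α.length ∧ Even (rIndex α γ - kIndex α γ) ∧
          paddedDiff α γ ∈ ZSet s α) →
        coeff s α γ = 0) ∧
      (coeff s α γ = 0 ∨ coeff s α γ = 1 ∨ coeff s α γ = -1)) ∧
    -- the Pieri rule for the dual immaculate basis
    (∃! D : Comp → QSym, IsDualImmaculate D) ∧
    (∀ D : Comp → QSym, IsDualImmaculate D →
      F [s] * D α = ∑ β ∈ compsOf ((size α : ℤ) + (s : ℤ)), coeff s β α • D β) ∧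
    -- the left Pieri rule for the immaculate basis
    (H (s : ℤ) * immaculate α = immaculate (s :: α) +
      ∑ i ∈ Finset.range (size α), ∑ γ ∈ compsOf ((size α : ℤ) - ((i + 1 : ℕ) : ℤ)),
        coeff i.succPNat α γ • immaculate ((s + i.succPNat) :: γ)) := by
  exact ⟨perp_F_immaculate s α, fun γ hγ => coeff_values s α hγ, existsUnique_isDualImmaculate,
    fun D hD => F_mul_dualImmaculate s α hD, H_mul_immaculate s α⟩
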